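/- **Setting.** Let $F$ be a totally real number field of degree $d$ with ring of integers $\mathfrak r$ and ring of finite adeles $\widehat F$, let $\mathfrak n\neq 0$ be an ideal of $\mathfrak r$, and let $p$ be an odd prime that is unramified in $F$ and prime to $\mathfrak n$; put $\mathfrak r_p=\mathfrak r\otimes\mathbb Z_p=\prod_{\mathfrak p\mid p}\mathfrak r_{\mathfrak p}$. For an ideal $\mathfrak m$ let $\Delta_0(\mathfrak m)$ be the semigroup of the matrices $\begin{pmatrix}a&b\\c&d\end{pmatrix}\in \mathrm{GL}_2(\widehat F)\cap \mathrm M_2(\widehat{\mathfrak r})$ with $c\equiv 0 \bmod \mathfrak m$, let $U_0(\mathfrak m)=\Delta_0(\mathfrak m)\cap\mathrm{GL}_2(\widehat{\mathfrak r})$, and let $U_1(\mathfrak m)$ (resp. $U(\mathfrak m)$) be the subgroup of $U_0(\mathfrak m)$ given by $a\equiv1$ (resp. $a\equiv d\equiv 1$) modulo $\mathfrak m$. Let $S$ be an open compact subgroup of $\mathrm{GL}_2(\widehat F)$ with $U_1(\mathfrak n)\subseteq S\subseteq U_0(\mathfrak n)$ such that for all $g\in \mathrm{GL}_2(\widehat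 F)$ the group $\Gamma/(\Gamma\cap F^\times)$, with $\Gamma=gSg^{-1}\cap \mathrm{GL}_2^+(F)$, is torsion-free. For an open subgroup $U$ of $S$ let $X_U=\mathrm{GL}_2(F)\backslash \mathrm{GL}_2(F_{\mathbb A})/U\,(\mathrm{SO}_2(\mathbb R)\mathbb R_+)^d$. A module $E$ on which $U$ operates on the right (the elements of $U\cap F^\times$ trivially) defines a local system $\mathcal E$ on $X_U$, whose singular $k$-cochains are the functions $c(g,\tau)\in E$ of $g\in\mathrm{GL}_2(\widehat F)$ and singular $k$-simplices $\tau$ of $\mathrm{GL}_2(\mathbb R)^d/(\mathrm{SO}_2(\mathbb R)\mathbb R_+)^d$ with $c(\gamma g,\gamma\tau)=c(g,\tau)$ for $\gamma\in\mathrm{GL}_2(F)$ and $c(gu,\tau)=c(g,\tau)|u$ for $u\in U$; $H^k_{\rm cpt}(X_U,\mathcal E)$ is its cohomology with compact support. If moreover the elements $s\in UxU$ operate on $E$ compatibly with $U$, the Hecke operator $T(x)$ is induced by $(c|T(x))(g,\tau)=\sum_{Us\subseteq UxU}c(gs^{-1},\tau)|s$. For a prime $\mathfrak q$ put $T(\mathfrak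 q)=T\begin{pmatrix}1&0\\0&q\end{pmatrix}$, where $q$ is an idele that generates $\mathfrak q$ at $\mathfrak q$ and is $1$ at the other primes; put $T(p)=T\begin{pmatrix}1&0\\0&\varpi\end{pmatrix}$, where $\varpi$ is the idele that is $p$ at the primes $\mathfrak p\mid p$ and $1$ at the other primes. *$\Lambda$-adic symbols.* Let $K$ be a finite extension of $\mathbb Q_p$ that receives all the $d$ embeddings of $F$, with ring of integers $\mathcal O$, and let $I$ be the set of embeddings $\sigma:F\to K$. Let $\bar{\mathfrak e}$ be the closure of $S\cap F^\times$ in $\mathfrak r_p^\times$ and $X=\bar{\mathfrak e}\backslash\big((\mathfrak r_p^2)'\times\mathfrak r_p^\times\big)$, where $(\mathfrak r_p^2)'=\prod_{\mathfrak p\mid p}(\mathfrak r_{\mathfrak p}^2)'$ is the set of the vectors that are primitive at each $\mathfrak p\mid p$, and $e\cdot((x,y),z)=((ex,ey),e^2z)$. For $s\in \mathrm{GL}_2(\widehat F)\cap \mathrm M_2(\widehat{\mathfrak r})$ put $((x,y),z)*s=((x,y)s_p,\ z\cdot\delta(s))$, where $\delta(s)\in\mathfrak r_p^\times$ has the component $p^{-c(\mathfrak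 p)}\det s_{\mathfrak p}$ at $\mathfrak p$, with $c(\mathfrak p)$ the valuation of $\det s_{\mathfrak p}$. Let $\mathbb D_X$ be the $\mathcal O$-module of $\mathcal O$-valued measures on $X$, let $\int_X\varphi\,d(\mu*s)$ be the integral of $\varphi(\eta*s)$ with respect to $\mu$ over the $\eta\in X$ with $\eta*s\in X$, and let $\mathbb W=H^d_{\rm cpt}(X_S,\mathcal D_X)$. *Classical symbols.* Let $n\in\mathbb Z_{\ge0}[I]$ and $v\in\mathbb Z[I]$ with $n_\sigma+2v_\sigma=m$ for all $\sigma$, let $\alpha\ge1$, and let $\epsilon:(\mathfrak r_p/p^\alpha)^\times\to\mathcal O^\times$ be a character with $\epsilon(e)\prod_\sigma\sigma(e)^m=1$ for $e\in\bar{\mathfrak e}$; write $\kappa$ for these data. Let $L(n,v,\epsilon,\mathcal O)$ be the module of the polynomials over $\mathcal O$ in the variables $X_\sigma,Y_\sigma$ ($\sigma\in I$), homogeneous of degree $n_\sigma$ in $X_\sigma,Y_\sigma$, with $(P|_\epsilon s)(X,Y)=\epsilon(a)\det(s_p)^vP\big((X,Y)s_p^*\big)$ for $s\in\Delta_0(p^\alpha)$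 with $s_p=\begin{pmatrix}a&b\\c&d\end{pmatrix}$ and $s_p^*=\begin{pmatrix}d&-b\\-c&a\end{pmatrix}$, where $z^v=\prod_\sigma\sigma(z)^{v_\sigma}$ and $\epsilon(a)=0$ if $a$ is not a unit. Let $U$ be an open subgroup with $S\cap U(p^\alpha)\subseteq U\subseteq S\cap U_0(p^\alpha)$, and let $\mathbb W_\kappa=H^d_{\rm cpt}(X_U,\mathcal L(n,v,\epsilon,\mathcal O))$. On $\mathbb W_\kappa$ there is the normalized operator $T_0(p)=(\{p\}^v)^{-1}T(p)$, with $\{p\}^v=\prod_\sigma p^{v_\sigma}$, in which $s$ operates on the coefficients by $P\mapsto(\{p\}^v)^{-1}P|_\epsilon s$ (this preserves $L(n,v,\epsilon,\mathcal O)$). Let $\rho_\kappa:\mathbb W\to\mathbb W_\kappa$ be the map induced by the projection $X_U\to X_S$ and by the $U$-equivariant map $$\rho_\kappa:\mathbb D_X\to L(n,v,\epsilon,\mathcal O),\qquad \rho_\kappa(\mu)=\int_{X'}z^v\epsilon(x)(xY-yX)^n\,d\mu(x,y,z),$$ where $X'=\{((x,y),z)\in X: x\in\mathfrak r_p^\times\}$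 and $(xY-yX)^n=\prod_\sigma(\sigma(x)Y_\sigma-\sigma(y)X_\sigma)^{n_\sigma}$. **Proposition.** Let $\Phi\in\mathbb W$. Then 1. $\rho_\kappa(\Phi*T(\mathfrak q))=\rho_\kappa(\Phi)|T(\mathfrak q)$ for every prime ideal $\mathfrak q$ of $\mathfrak r$ that does not divide $p$; 2. $\rho_\kappa(\Phi*T(p))=\rho_\kappa(\Phi)|T_0(p)$. -/

import Mathlib

open IsDedekindDomain HeightOneSpectrum NumberField MvPolynomial
open scoped Matrix

noncomputable section

namespace HilbertSymbols

section Local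

variable (F : Type*) [Field F] [NumberField F] (p : ℕ)

/-- The primes of `F` above `p`. -/
abbrev PlaceAbove : Type _ := {w : HeightOneSpectrum (𝓞 F) // (p : 𝓞 F) ∈ w.asIdeal}

/-- `𝔯_p = 𝔯 ⊗ ℤ_p`, as the product of the completions `𝔯_𝔭` over the primes `𝔭 ∣ p`. -/
abbrev Rp : Type _ := (w : PlaceAbove F p) → w.1.adicCompletionIntegers F

/-- `GL₂` of the ring of finite adeles of `F`. -/
abbrev GLf : Type _ := GL (Fin 2) (FiniteAdeleRing (𝓞 F) F)

variable {F}

/-- The component at `w` of a finite adele, as a ring homomorphism. -/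
def evalAt (w : HeightOneSpectrum (𝓞 F)) : FiniteAdeleRing (𝓞 F) F →+* w.adicCompletion F where
  toFun a := a w
  map_one' := rfl
  map_mul' _ _ := rfl
  map_zero' := rfl
  map_add' _ _ := rfl

/-- The component at `w` of an element of `GL₂` of the finite adeles. -/
def compAt (w : HeightOneSpectrum (𝓞 F)) : GLf F →* GL (Fin 2) (w.adicCompletion F) :=
  Matrix.GeneralLinearGroup.map (evalAt w)

/-- The inclusion `𝔯_w ⊆ F_w`. -/
abbrev inclAt (w : HeightOneSpectrum (𝓞 F)) : w.adicCompletionIntegers F →+* w.adicCompletion F :=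
  (w.adicCompletionIntegers F).subtype

/-- The ideal `𝔪 𝔯_w` of `𝔯_w`. -/
def idealAt (𝔪 : Ideal (𝓞 F)) (w : HeightOneSpectrum (𝓞 F)) : Ideal (w.adicCompletionIntegers F) :=
  𝔪.map (algebraMap (𝓞 F) (w.adicCompletionIntegers F))

lemma GL_inv_apply {R : Type*} [CommRing R] (k : GL (Fin 2) R) :
    ((k⁻¹ : GL (Fin 2) R) : Matrix (Fin 2) (Fin 2) R) =
      ((k.det⁻¹ : Rˣ) : R) • (k : Matrix (Fin 2) (Fin 2) R).adjugate := by
  rw [Matrix.coe_units_inv, Matrix.inv_def]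
  congr 1
  rw [← Matrix.GeneralLinearGroup.val_det_apply, Ring.inverse_unit]

lemma GL_det_inv_mul {R : Type*} [CommRing R] (k : GL (Fin 2) R) :
    ((k.det⁻¹ : Rˣ) : R) * (k 0 0 * k 1 1 - k 0 1 * k 1 0) = 1 := by
  rw [← Matrix.det_fin_two, ← Matrix.GeneralLinearGroup.val_det_apply, Units.inv_mul]

/-- Matrices in `GL₂(R)` with `c ∈ J`. -/
def localGamma0 {R : Type*} [CommRing R] (J : Ideal R) : Subgroup (GL (Fin 2) R) where
  carrier := {k | k 1 0 ∈ J}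
  one_mem' := by simp
  mul_mem' := by
    intro k l hk hl
    simp only [Set.mem_ofPred_eq, Units.val_mul, Matrix.mul_apply, Fin.sum_univ_two] at *
    exact J.add_mem (J.mul_mem_right _ hk) (J.mul_mem_left _ hl)
  inv_mem' := by
    intro k hk
    simp only [Set.mem_ofPred_eq, GL_inv_apply, Matrix.adjugate_fin_two, Matrix.smul_apply,
      Matrix.of_apply, Matrix.cons_val', Matrix.cons_val_zero, Matrix.cons_val_one,
      smul_eq_mul] at *
    exact J.mul_mem_left _ (J.neg_mem hk)

/-- Matrices in `GL₂(R)` with `c ∈ J` and `a - 1 ∈ J`. -/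
def localGamma1 {R : Type*} [CommRing R] (J : Ideal R) : Subgroup (GL (Fin 2) R) where
  carrier := {k | k 1 0 ∈ J ∧ k 0 0 - 1 ∈ J}
  one_mem' := by simp
  mul_mem' := by
    rintro k l ⟨hk, hk'⟩ ⟨hl, hl'⟩
    refine ⟨(localGamma0 J).mul_mem hk hl, ?_⟩
    simp only [Units.val_mul, Matrix.mul_apply, Fin.sum_univ_two]
    have : k 0 0 * l 0 0 + k 0 1 * l 1 0 - 1 =
      (k 0 0 - 1) * l 0 0 + (l 0 0 - 1) + k 0 1 * l 1 0 := by ring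
    rw [this]
    exact J.add_mem (J.add_mem (J.mul_mem_right _ hk') hl') (J.mul_mem_left _ hl)
  inv_mem' := by
    rintro k ⟨hk, hk'⟩
    refine ⟨(localGamma0 J).inv_mem hk, ?_⟩
    simp only [GL_inv_apply, Matrix.adjugate_fin_two, Matrix.smul_apply,
      Matrix.of_apply, Matrix.cons_val', Matrix.cons_val_zero, smul_eq_mul]
    have h1 := GL_det_inv_mul k
    have : ((k.det⁻¹ : Rˣ) : R) * k 1 1 - 1 =
      -(((k.det⁻¹ : Rˣ) : R) * k 1 1) * (k 0 0 - 1) + (((k.det⁻¹ : Rˣ) : R) * k 0 1) * k 1 0 := by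
      linear_combination h1
    rw [this]
    exact J.add_mem (J.mul_mem_left _ hk') (J.mul_mem_left _ hk)

/-- Matrices in `GL₂(R)` with `c ∈ J`, `a - 1 ∈ J` and `d - 1 ∈ J`. -/
def localGamma {R : Type*} [CommRing R] (J : Ideal R) : Subgroup (GL (Fin 2) R) where
  carrier := {k | k ∈ localGamma1 J ∧ k 1 1 - 1 ∈ J}
  one_mem' := ⟨(localGamma1 J).one_mem, by simp⟩
  mul_mem' := by
    rintro k l ⟨hk, hk'⟩ ⟨hl, hl'⟩
    refine ⟨(localGamma1 J).mul_mem hk hl, ?_⟩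
    simp only [Units.val_mul, Matrix.mul_apply, Fin.sum_univ_two]
    have : k 1 0 * l 0 1 + k 1 1 * l 1 1 - 1 =
      k 1 0 * l 0 1 + (k 1 1 - 1) * l 1 1 + (l 1 1 - 1) := by ring
    rw [this]
    exact J.add_mem (J.add_mem (J.mul_mem_right _ hk.1) (J.mul_mem_right _ hk')) hl'
  inv_mem' := by
    rintro k ⟨hk, hk'⟩
    refine ⟨(localGamma1 J).inv_mem hk, ?_⟩
    simp only [GL_inv_apply, Matrix.adjugate_fin_two, Matrix.smul_apply,
      Matrix.of_apply, Matrix.cons_val', Matrix.cons_val_one, smul_eq_mul]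
    change ((k.det⁻¹ : Rˣ) : R) * k 0 0 - 1 ∈ J
    have h1 := GL_det_inv_mul k
    have : ((k.det⁻¹ : Rˣ) : R) * k 0 0 - 1 =
      -(((k.det⁻¹ : Rˣ) : R) * k 0 0) * (k 1 1 - 1) + (((k.det⁻¹ : Rˣ) : R) * k 0 1) * k 1 0 := by
      linear_combination h1
    rw [this]
    exact J.add_mem (J.mul_mem_left _ hk') (J.mul_mem_left _ hk.1)

/-- The elements of `GL₂(F̂)` all of whose components lie in the local subgroups `H w`
of `GL₂(𝔯_w)`. -/
def globalize (H : ∀ w : HeightOneSpectrum (𝓞 F), Subgroup (GL (Fin 2) (w.adicCompletionIntegers F))) :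
    Subgroup (GLf F) :=
  ⨅ w, ((H w).map (Matrix.GeneralLinearGroup.map (inclAt w))).comap (compAt w)

/-- `U₀(𝔪)`. -/
def U0 (𝔪 : Ideal (𝓞 F)) : Subgroup (GLf F) := globalize fun w => localGamma0 (idealAt 𝔪 w)

/-- `U₁(𝔪)`. -/
def U1 (𝔪 : Ideal (𝓞 F)) : Subgroup (GLf F) := globalize fun w => localGamma1 (idealAt 𝔪 w)

/-- `U(𝔪)`. -/
def Ufull (𝔪 : Ideal (𝓞 F)) : Subgroup (GLf F) := globalize fun w => localGamma (idealAt 𝔪 w)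

/-- The semigroup `Δ₀(𝔪)` of integral matrices in `GL₂(F̂)` with `c ≡ 0 mod 𝔪`. -/
def Delta0 (𝔪 : Ideal (𝓞 F)) : Submonoid (GLf F) where
  carrier := {s | ∀ w : HeightOneSpectrum (𝓞 F),
    ∃ M : Matrix (Fin 2) (Fin 2) (w.adicCompletionIntegers F),
      (inclAt w).mapMatrix M = (compAt w s : Matrix (Fin 2) (Fin 2) (w.adicCompletion F)) ∧
        M 1 0 ∈ idealAt 𝔪 w}
  one_mem' := fun w => ⟨1, by simp, by simp⟩
  mul_mem' := by
    intro s t hs ht w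
    obtain ⟨M, hM, hM'⟩ := hs w
    obtain ⟨N, hN, hN'⟩ := ht w
    refine ⟨M * N, by rw [map_mul, hM, hN, map_mul, Units.val_mul], ?_⟩
    rw [Matrix.mul_apply, Fin.sum_univ_two]
    exact Ideal.add_mem _ (Ideal.mul_mem_right _ _ hM') (Ideal.mul_mem_left _ _ hN')

lemma U0_le_Delta0 (𝔪 : Ideal (𝓞 F)) : ∀ u ∈ U0 𝔪, u ∈ Delta0 𝔪 := by
  intro u hu w
  simp only [U0, globalize, Subgroup.mem_iInf, Subgroup.mem_comap, Subgroup.mem_map] at hu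
  obtain ⟨k, hk, hk'⟩ := hu w
  exact ⟨k, by rw [← hk']; rfl, hk⟩

lemma Delta0_mono {𝔪 𝔪' : Ideal (𝓞 F)} (h : 𝔪 ≤ 𝔪') : Delta0 𝔪 ≤ Delta0 𝔪' := by
  intro s hs w
  obtain ⟨M, hM, hM'⟩ := hs w
  exact ⟨M, hM, Ideal.map_mono h hM'⟩

lemma U0_mono {𝔪 𝔪' : Ideal (𝓞 F)} (h : 𝔪 ≤ 𝔪') : U0 𝔪 ≤ U0 𝔪' := by
  intro u hu
  simp only [U0, globalize, Subgroup.mem_iInf, Subgroup.mem_comap, Subgroup.mem_map] at hu ⊢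
  intro w
  obtain ⟨k, hk, hk'⟩ := hu w
  exact ⟨k, Ideal.map_mono h hk, hk'⟩

/-- An integral element of `F_w`, as an element of `𝔯_w`; the value `0` at non-integral elements
is never used. -/
def toInt (w : HeightOneSpectrum (𝓞 F)) (x : w.adicCompletion F) : w.adicCompletionIntegers F :=
  open Classical in if h : x ∈ w.adicCompletionIntegers F then ⟨x, h⟩ else 0

@[simp] lemma toInt_coe (w : HeightOneSpectrum (𝓞 F)) (x : w.adicCompletionIntegers F) :
    toInt w (x : w.adicCompletion F) = x := by
  simp [toInt]

lemma toInt_mul_unit (w : HeightOneSpectrum (𝓞 F)) (x : w.adicCompletion F)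
    (u : (w.adicCompletionIntegers F)ˣ) :
    toInt w (x * ((u : w.adicCompletionIntegers F) : w.adicCompletion F)) = toInt w x * u := by
  by_cases h : x ∈ w.adicCompletionIntegers F
  · lift x to w.adicCompletionIntegers F using h
    rw [← MulMemClass.coe_mul, toInt_coe, toInt_coe]
  · have h' : x * ((u : w.adicCompletionIntegers F) : w.adicCompletion F) ∉
        w.adicCompletionIntegers F := by
      intro h2
      apply h
      have := mul_mem h2 (((u⁻¹ : (w.adicCompletionIntegers F)ˣ) :
        w.adicCompletionIntegers F)).2
      rwa [mul_assoc, ← MulMemClass.coe_mul, Units.mul_inv, OneMemClass.coe_one, mul_one] at this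
    simp [toInt, h, h']

/-- The `p`-component of an element of `GL₂(F̂)` that is integral at `p`, as a matrix
over `𝔯_p`. -/
def pMat (s : GLf F) : Matrix (Fin 2) (Fin 2) (Rp F p) :=
  Matrix.of fun i j w => toInt w.1 (s i j w.1)

lemma pMat_coe {s : GLf F} (hs : s ∈ Delta0 (⊤ : Ideal (𝓞 F))) (i j : Fin 2) (w : PlaceAbove F p) :
    ((pMat p s i j w : w.1.adicCompletionIntegers F) : w.1.adicCompletion F) = s i j w.1 := by
  obtain ⟨M, hM, -⟩ := hs w.1
  have : ((M i j : w.1.adicCompletionIntegers F) : w.1.adicCompletion F) = s i j w.1 :=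
    congrFun (congrFun hM i) j
  simp only [pMat, Matrix.of_apply]
  rw [← this, toInt_coe]

lemma pMat_mul {s t : GLf F} (hs : s ∈ Delta0 (⊤ : Ideal (𝓞 F)))
    (ht : t ∈ Delta0 (⊤ : Ideal (𝓞 F))) : pMat p (s * t) = pMat p s * pMat p t := by
  ext i j w
  rw [pMat_coe p (mul_mem hs ht)]
  simp only [Matrix.mul_apply, Fin.sum_univ_two, Units.val_mul, Pi.add_apply, Pi.mul_apply,
    AddMemClass.coe_add, MulMemClass.coe_mul]
  rw [pMat_coe p hs, pMat_coe p hs, pMat_coe p ht, pMat_coe p ht]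
  rfl

@[simp] lemma pMat_one : pMat p (1 : GLf F) = 1 := by
  ext i j w
  rw [pMat_coe p (one_mem _)]
  fin_cases i <;> fin_cases j <;> rfl

lemma isUnit_det_pMat {u : GLf F} (hu : u ∈ U0 (⊤ : Ideal (𝓞 F))) : IsUnit (pMat p u).det := by
  have h : pMat p u * pMat p u⁻¹ = 1 := by
    rw [← pMat_mul p (U0_le_Delta0 _ u hu) (U0_le_Delta0 _ _ (inv_mem hu)), mul_inv_cancel,
      pMat_one]
  exact IsUnit.of_mul_eq_one _ (by rw [← Matrix.det_mul, h, Matrix.det_one])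

end Local

section Embeddings

variable (K : Type*) [NormedField K] [IsUltrametricDist K]

/-- The ring of integers `𝒪 = {x : ‖x‖ ≤ 1}` of `K`. -/
def OK : Subring K where
  carrier := {x | ‖x‖ ≤ 1}
  one_mem' := by simp
  mul_mem' := by
    intro a b ha hb
    simp only [Set.mem_ofPred_eq, norm_mul] at *
    exact mul_le_one₀ ha (norm_nonneg _) hb
  zero_mem' := by simp
  add_mem' := by
    intro a b ha hb
    exact (IsUltrametricDist.norm_add_le_max a b).trans (max_le ha hb)
  neg_mem' := by
    intro a ha
    simpa using ha

variable {K}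

/-- An element of norm at most `1`, as an element of `𝒪`; the value `0` at the other elements
is never used. -/
def toO (x : K) : OK K := open Classical in if h : ‖x‖ ≤ 1 then ⟨x, h⟩ else 0

@[simp] lemma toO_coe (x : OK K) : toO (x : K) = x := by
  have : ‖(x : K)‖ ≤ 1 := x.2
  simp [toO, this]

lemma coe_toO {x : K} (h : ‖x‖ ≤ 1) : ((toO x : OK K) : K) = x := by
  simp [toO, h]

lemma toO_mul_of_norm_eq_one (x y : K) (hy : ‖y‖ = 1) : toO (x * y) = toO x * toO y := by
  by_cases h : ‖x‖ ≤ 1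
  · apply Subtype.ext
    rw [Subring.coe_mul, coe_toO h, coe_toO hy.le, coe_toO (by rw [norm_mul, hy, mul_one]; exact h)]
  · have h' : ¬ ‖x * y‖ ≤ 1 := by rwa [norm_mul, hy, mul_one]
    simp only [toO, h, h', dif_neg, not_false_eq_true, zero_mul]

lemma norm_embedding_le_one {F : Type*} [Field F] (σ : F →+* K) (a : 𝓞 F) : ‖σ a‖ ≤ 1 := by
  have h1 : IsIntegral ℤ (σ (a : F)) := (map_isIntegral_int σ a.isIntegral_coe)
  have h2 : IsIntegral (NormedField.valuation (K := K)).integer (σ (a : F)) := h1.tower_top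
  have h3 := (Valuation.integer.integers (NormedField.valuation (K := K))).mem_of_integral h2
  exact h3

lemma norm_prime_lt_one {K : Type*} [NormedField K] (p : ℕ) [Fact p.Prime]
    [NormedAlgebra ℚ_[p] K] : ‖(p : K)‖ < 1 := by
  rw [← map_natCast (algebraMap ℚ_[p] K) p, norm_algebraMap']
  exact Padic.norm_p_lt_one

lemma natCast_prime_ne_zero {K : Type*} [NormedField K] (p : ℕ) [Fact p.Prime]
    [NormedAlgebra ℚ_[p] K] : (p : K) ≠ 0 := by
  rw [← map_natCast (algebraMap ℚ_[p] K) p, Ne, map_eq_zero]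
  exact_mod_cast (Fact.out : p.Prime).ne_zero

/-- The prime of `F` above `p` induced by an embedding `σ` of `F` into the `p`-adic field `K`. -/
def placeOf {F : Type*} [Field F] [NumberField F] (p : ℕ) [Fact p.Prime] [NormedAlgebra ℚ_[p] K]
    (σ : F →+* K) : PlaceAbove F p :=
  ⟨{ asIdeal :=
      { carrier := {a | ‖σ a‖ < 1}
        add_mem' := by
          intro a b ha hb
          simp only [Set.mem_ofPred_eq, map_add] at *
          exact (IsUltrametricDist.norm_add_le_max _ _).trans_lt (max_lt ha hb)
        zero_mem' := by simp
        smul_mem' := by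
          intro a b hb
          simp only [Set.mem_ofPred_eq, smul_eq_mul, map_mul, norm_mul] at *
          exact mul_lt_one_of_nonneg_of_lt_one_right (norm_embedding_le_one σ a)
            (norm_nonneg _) hb }
     isPrime := by
      constructor
      · rw [Ne, Ideal.eq_top_iff_one]
        change ¬ ‖σ ((1 : 𝓞 F) : F)‖ < 1
        simp
      · intro a b hab
        change ‖σ ((a * b : 𝓞 F) : F)‖ < 1 at hab
        change ‖σ (a : F)‖ < 1 ∨ ‖σ (b : F)‖ < 1
        by_contra! h
        rw [show ((a * b : 𝓞 F) : F) = (a : F) * (b : F) from rfl, map_mul, norm_mul] at hab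
        exact absurd hab (not_lt.2 (one_le_mul_of_one_le_of_one_le h.1 h.2))
     ne_bot := by
      intro h
      have h1 : (p : 𝓞 F) ∈ (⊥ : Ideal (𝓞 F)) := by
        rw [← h]
        change ‖σ ((p : 𝓞 F) : F)‖ < 1
        simpa using norm_prime_lt_one (K := K) p
      rw [Ideal.mem_bot] at h1
      exact (Fact.out : p.Prime).ne_zero (by exact_mod_cast h1) }, by
    change ‖σ ((p : 𝓞 F) : F)‖ < 1
    simpa using norm_prime_lt_one (K := K) p⟩

section

variable {F : Type*} [Field F] [NumberField F] (p : ℕ) [Fact p.Prime] [NormedAlgebra ℚ_[p] K]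
  (σ : F →+* K)

lemma norm_le_one_of_valuation_le_one {x : F} (hx : (placeOf p σ).1.valuation F x ≤ 1) :
    ‖σ x‖ ≤ 1 := by
  obtain ⟨a, b, hab⟩ := exists_primeCompl_mul_eq_of_integer (placeOf p σ).1 x hx
  have hb : ‖σ ((b : 𝓞 F) : F)‖ = 1 := by
    refine le_antisymm (norm_embedding_le_one σ _) (not_lt.1 ?_)
    exact b.2
  have h := congrArg (fun y => ‖σ y‖) hab
  simp only [map_mul, norm_mul] at h
  have h1 : ‖σ x‖ * 1 = ‖σ (a : F)‖ := by rw [← hb]; exact h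
  rw [← mul_one ‖σ x‖, h1]
  exact norm_embedding_le_one σ a

/-- `σ`, seen as a homomorphism from `F` with its `𝔭_σ`-adic topology. -/
def embWithVal : WithVal ((placeOf p σ).1.valuation F) →+* K :=
  σ.comp (WithVal.equiv ((placeOf p σ).1.valuation F)).toRingHom

lemma continuous_embWithVal : Continuous (embWithVal p σ) := by
  refine continuous_of_continuousAt_zero (embWithVal p σ).toAddMonoidHom ?_
  rw [ContinuousAt, Metric.tendsto_nhds]
  intro ε hε
  obtain ⟨k, hk⟩ := exists_pow_lt_of_lt_one hε (norm_prime_lt_one (K := K) p)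
  have hp0 : (p : F) ≠ 0 := by exact_mod_cast (Fact.out : p.Prime).ne_zero
  have hv0 : Valued.v.restrict (WithVal.toVal ((placeOf p σ).1.valuation F) ((p : F) ^ k)) ≠ 0 := by
    simp [(Fact.out : p.Prime).ne_zero]
  refine Filter.mem_of_superset (Valued.mem_nhds_zero.2 ⟨Units.mk0 _ hv0, subset_rfl⟩) ?_
  intro x hx
  simp only [Set.mem_ofPred_eq, Units.val_mk0, Valuation.restrict_lt_iff] at hx
  change (placeOf p σ).1.valuation F x.ofVal < (placeOf p σ).1.valuation F ((p : F) ^ k) at hx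
  change dist (σ x.ofVal) (σ 0) < ε
  rw [map_zero, dist_zero_right]
  have hy : ‖σ (x.ofVal / (p : F) ^ k)‖ ≤ 1 := by
    apply norm_le_one_of_valuation_le_one p σ
    rw [map_div₀]
    exact div_le_one_of_le₀ hx.le zero_le
  have hxy : x.ofVal = (p : F) ^ k * (x.ofVal / (p : F) ^ k) := by
    field_simp
  rw [hxy, map_mul, map_pow, map_natCast, norm_mul, norm_pow]
  exact (mul_le_of_le_one_right (by positivity) hy).trans_lt hk

variable [FiniteDimensional ℚ_[p] K]

/-- The continuous extension `F_{𝔭_σ} → K` of the embedding `σ : F → K`. -/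
def localEmb : (placeOf p σ).1.adicCompletion F →+* K :=
  haveI : CompleteSpace K := FiniteDimensional.complete ℚ_[p] K
  (IsDenseInducing.extendRingHom
    (i := UniformSpace.Completion.coeRingHom (α := WithVal ((placeOf p σ).1.valuation F)))
    (f := embWithVal p σ)
    (UniformSpace.Completion.isUniformInducing_coe _)
    UniformSpace.Completion.denseRange_coe
    (uniformContinuous_addMonoidHom_of_continuous (f := (embWithVal p σ).toAddMonoidHom)
      (continuous_embWithVal p σ))).comp
  (adicCompletion.equiv F (placeOf p σ).1).toRingHom

lemma continuous_localEmb : Continuous (localEmb p σ) := by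
  have : CompleteSpace K := FiniteDimensional.complete ℚ_[p] K
  have h := uniformContinuous_uniformly_extend
    (e := UniformSpace.Completion.coeRingHom (α := WithVal ((placeOf p σ).1.valuation F)))
    (UniformSpace.Completion.isUniformInducing_coe _) UniformSpace.Completion.denseRange_coe
    (uniformContinuous_addMonoidHom_of_continuous (f := (embWithVal p σ).toAddMonoidHom)
      (continuous_embWithVal p σ))
  exact h.continuous.comp (adicCompletion.continuous_toCompletion F (placeOf p σ).1)

lemma localEmb_coe (a : F) :
    localEmb p σ (algebraMap F ((placeOf p σ).1.adicCompletion F) a) = σ a := by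
  have : CompleteSpace K := FiniteDimensional.complete ℚ_[p] K
  exact uniformly_extend_of_ind
    (e := UniformSpace.Completion.coeRingHom (α := WithVal ((placeOf p σ).1.valuation F)))
    (UniformSpace.Completion.isUniformInducing_coe _) UniformSpace.Completion.denseRange_coe
    (uniformContinuous_addMonoidHom_of_continuous (f := (embWithVal p σ).toAddMonoidHom)
      (continuous_embWithVal p σ)) (WithVal.toVal _ a)

lemma norm_localEmb_le_one (x : (placeOf p σ).1.adicCompletionIntegers F) :
    ‖localEmb p σ x‖ ≤ 1 := by
  have hd : Dense (Set.range (algebraMap F ((placeOf p σ).1.adicCompletion F))) :=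
    HeightOneSpectrum.denseRange_algebraMap F (placeOf p σ).1
  have hx := hd.open_subset_closure_inter
    (Valued.isOpen_valuationSubring ((placeOf p σ).1.adicCompletion F)) x.2
  have hc : IsClosed {y : (placeOf p σ).1.adicCompletion F | ‖localEmb p σ y‖ ≤ 1} :=
    isClosed_le (continuous_localEmb p σ).norm continuous_const
  refine closure_minimal ?_ hc hx
  rintro _ ⟨hy, a, rfl⟩
  change ‖localEmb p σ _‖ ≤ 1
  rw [localEmb_coe]
  apply norm_le_one_of_valuation_le_one p σ
  have h2 : Valued.v (algebraMap F ((placeOf p σ).1.adicCompletion F) a) ≤ 1 := hy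
  rwa [algebraMap_adicCompletion, Function.comp_apply, Algebra.algebraMap_self, RingHom.id_apply,
    valuedAdicCompletion_eq_valuation'] at h2

/-- The continuous ring homomorphism `𝔯_p → 𝒪` that extends `σ : 𝔯 → 𝒪`. -/
def embO : Rp F p →+* OK K where
  toFun x := ⟨localEmb p σ (x (placeOf p σ)), norm_localEmb_le_one p σ _⟩
  map_one' := by apply Subtype.ext; simp
  map_mul' x y := by apply Subtype.ext; simp
  map_zero' := by apply Subtype.ext; simp
  map_add' x y := by apply Subtype.ext; simp

lemma continuous_embO : Continuous (embO p σ) := by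
  refine Continuous.subtype_mk (f := fun x : Rp F p =>
    localEmb p σ (x (placeOf p σ) : (placeOf p σ).1.adicCompletion F)) ?_ _
  exact (continuous_localEmb p σ).comp (continuous_subtype_val.comp (continuous_apply _))

lemma norm_embO_unit {z : Rp F p} (hz : IsUnit z) : ‖(embO p σ z : K)‖ = 1 := by
  obtain ⟨u, rfl⟩ := hz
  have h1 : ‖((embO p σ u : OK K) : K)‖ ≤ 1 := (embO p σ u).2
  have h2 : ‖((embO p σ ((u⁻¹ : (Rp F p)ˣ) : Rp F p) : OK K) : K)‖ ≤ 1 := (embO p σ _).2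
  have h3 : ‖((embO p σ u : OK K) : K)‖ * ‖((embO p σ ((u⁻¹ : (Rp F p)ˣ) : Rp F p) : OK K) : K)‖
      = 1 := by
    rw [← norm_mul, ← Subring.coe_mul, ← map_mul, Units.mul_inv, map_one]
    simp
  nlinarith [norm_nonneg ((embO p σ u : OK K) : K)]

end

end Embeddings

section Cohomology

/-- The set `U \ U x U` of the right cosets `U s` contained in `U x U`. -/
def doubleCosets {G : Type*} [Group G] (U : Subgroup G) (x : G) : Set (Quotient (QuotientGroup.rightRel U)) :=
  {q | ∃ u ∈ U, q = Quotient.mk _ (x * u)}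

lemma finite_doubleCosets {G : Type*} [Group G] [TopologicalSpace G] [IsTopologicalGroup G]
    {U : Subgroup G} (hUo : IsOpen (U : Set G)) (hUc : IsCompact (U : Set G))
    (x : G) : (doubleCosets U x).Finite := by
  obtain ⟨t, ht⟩ := hUc.elim_finite_subcover
    (fun q : Quotient (QuotientGroup.rightRel U) => {y | Quotient.mk _ (x * y) = q})
    (fun q => by
      rw [isOpen_iff_mem_nhds]
      intro y hy
      have hcont : Continuous fun z : G => (x * z) * (x * y)⁻¹ := by fun_prop
      refine Filter.mem_of_superset ((hUo.preimage hcont).mem_nhds ?_) ?_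
      · simp
      · intro z hz
        rw [Set.mem_ofPred_eq] at hy ⊢
        rw [← hy]
        refine Quotient.sound ?_
        have := U.inv_mem hz
        rw [mul_inv_rev, inv_inv] at this
        exact QuotientGroup.rightRel_apply.2 this)
    (fun y _ => Set.mem_iUnion.2 ⟨_, rfl⟩)
  refine t.finite_toSet.subset ?_
  rintro q ⟨u, hu, rfl⟩
  obtain ⟨q, hq, h⟩ := Set.mem_iUnion₂.1 (ht hu)
  exact h ▸ hq

lemma out_mem {G : Type*} [Group G] {U : Subgroup G} {x : G} {q : Quotient (QuotientGroup.rightRel U)} (hq : q ∈ doubleCosets U x) :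
    ∃ a ∈ U, ∃ b ∈ U, q.out = a * x * b := by
  obtain ⟨u, hu, rfl⟩ := hq
  have h := QuotientGroup.rightRel_apply.1 (Quotient.mk_out (s := QuotientGroup.rightRel U) (x * u))
  refine ⟨_, U.inv_mem h, u, hu, ?_⟩
  group

lemma isCompact_mulDoubleCoset {G D : Type*} [Group G] [TopologicalSpace G] [IsTopologicalGroup G]
    [TopologicalSpace D] {C : Set (G × D)} (hC : IsCompact C) {U : Set G} (hU : IsCompact U)
    (x : G) :
    IsCompact ((fun z : ((G × D) × G) × G => (z.1.1.1 * z.1.2 * x * z.2, z.1.1.2)) ''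
      ((C ×ˢ U) ×ˢ U)) :=
  ((hC.prod hU).prod hU).image (by fun_prop)

lemma isCompact_mulInv {G D : Type*} [Group G] [TopologicalSpace G] [IsTopologicalGroup G]
    [TopologicalSpace D] {C : Set (G × D)} (hC : IsCompact C) {U : Set G} (hU : IsCompact U) :
    IsCompact ((fun z : (G × D) × G => (z.1.1 * z.2⁻¹, z.1.2)) '' (C ×ˢ U)) :=
  (hC.prod hU).image (by fun_prop)

/-- The group `ℝ₊ · SO₂(ℝ)` of the nonzero matrices `(a, b; -b, a)`. -/
def conformalGroup : Subgroup (GL (Fin 2) ℝ) where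
  carrier := {g | g 0 0 = g 1 1 ∧ g 0 1 = -g 1 0}
  one_mem' := by simp
  mul_mem' := by
    rintro g h ⟨hg, hg'⟩ ⟨hh, hh'⟩
    simp only [Set.mem_ofPred_eq, Units.val_mul, Matrix.mul_apply, Fin.sum_univ_two]
    rw [hg, hg', hh, hh']
    constructor <;> ring
  inv_mem' := by
    rintro g ⟨hg, hg'⟩
    simp only [Set.mem_ofPred_eq, GL_inv_apply, Matrix.adjugate_fin_two, Matrix.smul_apply,
      Matrix.of_apply, Matrix.cons_val', Matrix.cons_val_zero, Matrix.cons_val_one, smul_eq_mul]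
    constructor
    · exact congrArg _ hg.symm
    · change _ * (-g 0 1) = -(_ * (-g 1 0))
      rw [hg']; ring

variable (F : Type*) [Field F] [NumberField F]

/-- The archimedean part `GL₂(ℝ)^d` of `GL₂(F_𝔸)`, for a totally real field `F`. -/
abbrev GLinf : Type _ := (F →+* ℝ) → GL (Fin 2) ℝ

/-- `S_∞ = (SO₂(ℝ) ℝ₊)^d`. -/
def Sinf : Subgroup (GLinf F) := Subgroup.pi Set.univ fun _ => conformalGroup

/-- The symmetric space `GL₂(ℝ)^d / S_∞`, that is, `(ℂ ∖ ℝ)^d`. -/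
abbrev SymSpace : Type _ := GLinf F ⧸ Sinf F

variable {F}

/-- The diagonal embedding of `GL₂(F)` in `GL₂(ℝ)^d`. -/
def toGLinf : GL (Fin 2) F →* GLinf F :=
  MonoidHom.mk' (fun γ σ => Matrix.GeneralLinearGroup.map σ γ) fun γ γ' => by
    funext σ; exact map_mul _ _ _

/-- The diagonal embedding of `GL₂(F)` in `GL₂(F̂)`. -/
def toGLf : GL (Fin 2) F →* GLf F :=
  Matrix.GeneralLinearGroup.map (algebraMap F (FiniteAdeleRing (𝓞 F) F))

variable (F) in
/-- Singular `k`-simplices of the symmetric space. -/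
abbrev Simplex (k : ℕ) : Type _ := C(stdSimplex ℝ (Fin (k + 1)), SymSpace F)

/-- The translate of a singular simplex by an element of `GL₂(F)`. -/
def translate {k : ℕ} (γ : GL (Fin 2) F) (τ : Simplex F k) : Simplex F k :=
  ⟨fun t => toGLinf γ • τ t, Continuous.const_smul (map_continuous τ) (toGLinf γ)⟩

/-- The `i`-th face of a singular simplex. -/
def face {k : ℕ} (i : Fin (k + 2)) (τ : Simplex F (k + 1)) : Simplex F k :=
  ⟨fun t => τ (stdSimplex.map i.succAbove t), (map_continuous τ).comp (stdSimplex.continuous_map _)⟩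

lemma face_translate {F : Type*} [Field F] {k : ℕ} (i : Fin (k + 2)) (γ : GL (Fin 2) F) (τ : Simplex F (k + 1)) :
    face i (translate γ τ) = translate γ (face i τ) := rfl

variable {R : Type*} [CommRing R] {E : Type*} [AddCommGroup E] [Module R E]

/-- All functions of `g ∈ GL₂(F̂)` and a singular `k`-simplex, with values in `E`. -/
def CochainFun (F : Type*) [Field F] [NumberField F] (E : Type*) (k : ℕ) : Type _ :=
  GLf F → Simplex F k → E

instance (k : ℕ) : AddCommGroup (CochainFun F E k) :=
  inferInstanceAs (AddCommGroup (GLf F → Simplex F k → E))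

instance (k : ℕ) : Module R (CochainFun F E k) :=
  inferInstanceAs (Module R (GLf F → Simplex F k → E))

@[simp] lemma CochainFun.add_apply {F : Type*} [Field F] [NumberField F] {E : Type*}
    [AddCommGroup E] {k : ℕ} (c c' : CochainFun F E k) (g : GLf F) (τ : Simplex F k) :
    (c + c') g τ = c g τ + c' g τ := rfl

@[simp] lemma CochainFun.smul_apply {k : ℕ} (r : R) (c : CochainFun F E k) (g : GLf F)
    (τ : Simplex F k) : (r • c) g τ = r • c g τ := rfl

@[simp] lemma CochainFun.zero_apply {F : Type*} [Field F] [NumberField F] {E : Type*}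
    [AddCommGroup E] {k : ℕ} (g : GLf F) (τ : Simplex F k) :
    (0 : CochainFun F E k) g τ = 0 := rfl

/-- Compactly supported singular `k`-cochains on
`X_U = GL₂(F) \ GL₂(F_𝔸) / (U · S_∞)` with values in the local system attached to a module `E`
on which `u ∈ U` operates on the right by `act u`. A singular simplex of `GL₂(F_𝔸) / (U · S_∞)` is
a pair `(g U, τ)` with `g ∈ GL₂(F̂)` and `τ` a singular simplex of the symmetric space; a cochain is
a function of `(g, τ)` with `c (γ g) (γ τ) = c g τ` for `γ ∈ GL₂(F)` and
`c (g u) τ = c g τ | u` for `u ∈ U`, and it has compact support if it vanishes on all the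
simplices of `X_U` that do not meet a suitable compact subset (the image of `C`) of `X_U`. -/
def Cochain (U : Subgroup (GLf F)) (act : GLf F → E →ₗ[R] E) (k : ℕ) :
    Submodule R (CochainFun F E k) where
  carrier := {c | (∀ γ g τ, c (toGLf γ * g) (translate γ τ) = c g τ) ∧
    (∀ u ∈ U, ∀ g τ, c (g * u) τ = act u (c g τ)) ∧
    ∃ C : Set (GLf F × SymSpace F), IsCompact C ∧ ∀ g τ, c g τ ≠ 0 →
      ∃ (γ : GL (Fin 2) F) (u : GLf F) (t : stdSimplex ℝ (Fin (k + 1))),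
        u ∈ U ∧ (toGLf γ * g * u, toGLinf γ • τ t) ∈ C}
  zero_mem' := ⟨fun _ _ _ => rfl, fun u _ g τ => by simp, ∅, isCompact_empty,
    fun g τ h => absurd rfl h⟩
  add_mem' := by
    rintro c c' ⟨h1, h2, C, hC, h3⟩ ⟨h1', h2', C', hC', h3'⟩
    refine ⟨fun γ g τ => by simp [h1, h1'], fun u hu g τ => by simp [h2 u hu, h2' u hu],
      C ∪ C', hC.union hC', fun g τ h => ?_⟩
    by_cases hc : c g τ = 0
    · have hc' : c' g τ ≠ 0 := fun h0 => h (by simp [hc, h0])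
      obtain ⟨γ, u, t, hu, ht⟩ := h3' g τ hc'
      exact ⟨γ, u, t, hu, Or.inr ht⟩
    · obtain ⟨γ, u, t, hu, ht⟩ := h3 g τ hc
      exact ⟨γ, u, t, hu, Or.inl ht⟩
  smul_mem' := by
    rintro r c ⟨h1, h2, C, hC, h3⟩
    refine ⟨fun γ g τ => by simp [h1], fun u hu g τ => by simp [h2 u hu], C, hC, fun g τ h => ?_⟩
    exact h3 g τ fun h0 => h (by simp [h0])

variable {U : Subgroup (GLf F)} {act : GLf F → E →ₗ[R] E}

/-- The singular coboundary. -/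
def coboundary (U : Subgroup (GLf F)) (act : GLf F → E →ₗ[R] E) (k : ℕ) :
    Cochain U act k →ₗ[R] Cochain U act (k + 1) where
  toFun c := ⟨fun g τ => ∑ i : Fin (k + 2), (-1 : R) ^ (i : ℕ) • c.1 g (face i τ), by
    obtain ⟨c, h1, h2, C, hC, h3⟩ := c
    refine ⟨fun γ g τ => ?_, fun u hu g τ => ?_, C, hC, fun g τ h => ?_⟩
    · simp only [face_translate, h1]
    · simp only [map_sum, map_smul, h2 u hu]
    · obtain ⟨i, -, hi⟩ := Finset.exists_ne_zero_of_sum_ne_zero h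
      obtain ⟨γ, u, t, hu, ht⟩ := h3 g (face i τ) fun h0 => hi (by simp [h0])
      exact ⟨γ, u, stdSimplex.map i.succAbove t, hu, ht⟩⟩
  map_add' c c' := by
    apply Subtype.ext; funext g τ
    change ∑ i : Fin (k + 2), (-1 : R) ^ (i : ℕ) • (c.1 g (face i τ) + c'.1 g (face i τ)) =
      ∑ i : Fin (k + 2), (-1 : R) ^ (i : ℕ) • c.1 g (face i τ) +
        ∑ i : Fin (k + 2), (-1 : R) ^ (i : ℕ) • c'.1 g (face i τ)
    simp only [smul_add, Finset.sum_add_distrib]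
  map_smul' r c := by
    apply Subtype.ext; funext g τ
    change ∑ i : Fin (k + 2), (-1 : R) ^ (i : ℕ) • (r • c.1 g (face i τ)) =
      r • ∑ i : Fin (k + 2), (-1 : R) ^ (i : ℕ) • c.1 g (face i τ)
    simp only [Finset.smul_sum, smul_comm r]

/-- The coboundaries in degree `k`. -/
def boundaries (U : Subgroup (GLf F)) (act : GLf F → E →ₗ[R] E) :
    ∀ k : ℕ, Submodule R (Cochain U act k)
  | 0 => ⊥
  | k + 1 => LinearMap.range (coboundary U act k)

/-- The cohomology with compact support `H^k_cpt(X_U, ℰ)`. -/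
abbrev Hcpt (U : Subgroup (GLf F)) (act : GLf F → E →ₗ[R] E) (k : ℕ) : Type _ :=
  LinearMap.ker (coboundary U act k) ⧸
    (boundaries U act k).comap (LinearMap.ker (coboundary U act k)).subtype

/-- The map induced in cohomology by a map of complexes. -/
def Hcpt.map {E' : Type*} [AddCommGroup E'] [Module R E'] {U' : Subgroup (GLf F)}
    {act' : GLf F → E' →ₗ[R] E'}
    (f : ∀ k, Cochain U act k →ₗ[R] Cochain U' act' k)
    (hf : ∀ k c, f (k + 1) (coboundary U act k c) = coboundary U' act' k (f k c)) (k : ℕ) :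
    Hcpt U act k →ₗ[R] Hcpt U' act' k :=
  Submodule.mapQ _ _
    ((f k).restrict (p := LinearMap.ker (coboundary U act k))
      (q := LinearMap.ker (coboundary U' act' k)) fun c hc => by
        rw [LinearMap.mem_ker] at hc ⊢
        rw [← hf, hc, map_zero])
    (by
      rintro ⟨c, hc⟩ h
      rw [Submodule.mem_comap] at h
      rw [Submodule.mem_comap, Submodule.mem_comap]
      change c ∈ boundaries U act k at h
      change f k c ∈ boundaries U' act' k
      cases k with
      | zero =>
        change c = 0 at h
        change f 0 c = 0
        rw [h, map_zero]
      | succ k =>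
        obtain ⟨b, rfl⟩ := h
        exact ⟨f k b, (hf k b).symm⟩)

/-- The map of cochains induced by an equivariant map of coefficients `f : E → E'` and the
projection `X_{U'} → X_U`, for `U' ≤ U` and `U` compact. -/
def pushCochain {E' : Type*} [AddCommGroup E'] [Module R E'] {U' : Subgroup (GLf F)}
    {act' : GLf F → E' →ₗ[R] E'} (hU : U' ≤ U) (hc : IsCompact (U : Set (GLf F)))
    (f : E →ₗ[R] E') (hf : ∀ u ∈ U', ∀ e, f (act u e) = act' u (f e)) (k : ℕ) :
    Cochain U act k →ₗ[R] Cochain U' act' k where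
  toFun c := ⟨fun g τ => f (c.1 g τ), by
    obtain ⟨c, h1, h2, C, hC, h3⟩ := c
    refine ⟨fun γ g τ => by simp only [h1], fun u hu g τ => by simp only [h2 u (hU hu), hf u hu],
      _, isCompact_mulInv hC hc, fun g τ h => ?_⟩
    obtain ⟨γ, u, t, hu, ht⟩ := h3 g τ fun h0 => h (by simp [h0])
    exact ⟨γ, 1, t, one_mem _, ((_, _), u), ⟨ht, hu⟩, by simp⟩⟩
  map_add' c c' := by
    apply Subtype.ext; funext g τ
    exact map_add f (c.1 g τ) (c'.1 g τ)
  map_smul' r c := by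
    apply Subtype.ext; funext g τ
    exact map_smul f r (c.1 g τ)

/-- A family of operators `op s` on `E`, for `s ∈ U x U`, that is compatible on both sides with
the right operation of `U` on `E`. -/
def HeckeCompat (U : Subgroup (GLf F)) (act : GLf F → E →ₗ[R] E) (x : GLf F)
    (op : GLf F → E →ₗ[R] E) : Prop :=
  ∀ a ∈ U, ∀ b ∈ U, ∀ u ∈ U,
    op (u * (a * x * b)) = op (a * x * b) ∘ₗ act u ∧
    op (a * x * b * u) = act u ∘ₗ op (a * x * b)

/-- The sum `∑ c(g s⁻¹, τ) | s` over the right cosets `U s ⊆ U x U`. -/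
def heckeFun (U : Subgroup (GLf F)) (x : GLf F) (op : GLf F → E →ₗ[R] E) {k : ℕ}
    (c : CochainFun F E k) : CochainFun F E k :=
  fun g τ => ∑ᶠ q ∈ doubleCosets U x, op q.out (c (g * q.out⁻¹) τ)

/-- The summand of a Hecke operator depends only on the coset. -/
lemma heckeTerm_eq {x : GLf F} {op : GLf F → E →ₗ[R] E} (hop : HeckeCompat U act x op) {k : ℕ}
    (c : Cochain U act k) (g : GLf F) (τ : Simplex F k) {s s' : GLf F}
    (hs : ∃ a ∈ U, ∃ b ∈ U, s = a * x * b)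
    (h : Quotient.mk (QuotientGroup.rightRel U) s = Quotient.mk _ s') :
    op s' (c.1 (g * s'⁻¹) τ) = op s (c.1 (g * s⁻¹) τ) := by
  obtain ⟨a, ha, b, hb, rfl⟩ := hs
  have hu := QuotientGroup.rightRel_apply.1 (Quotient.exact h)
  obtain ⟨u, hu', rfl⟩ : ∃ u ∈ U, s' = u * (a * x * b) := ⟨_, hu, by group⟩
  rw [(hop a ha b hb u hu').1, LinearMap.comp_apply, ← c.2.2.1 u hu']
  congr 3
  group

lemma heckeFun_mem (hUo : IsOpen (U : Set (GLf F))) (hUc : IsCompact (U : Set (GLf F)))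
    {x : GLf F} {op : GLf F → E →ₗ[R] E} (hop : HeckeCompat U act x op) {k : ℕ}
    (c : Cochain U act k) : heckeFun U x op c.1 ∈ Cochain U act k := by
  have hfin := finite_doubleCosets hUo hUc x
  obtain ⟨h1, h2, C, hC, h3⟩ := c.2
  refine ⟨fun γ g τ => ?_, fun u hu g τ => ?_, ?_⟩
  · simp only [heckeFun, mul_assoc, h1]
  · rw [heckeFun, heckeFun, ← LinearMap.toAddMonoidHom_coe, AddMonoidHom.map_finsum_mem _ _ hfin]
    refine finsum_mem_eq_of_bijOn
      (fun q => Quotient.map' (s₂ := QuotientGroup.rightRel U) (fun s => s * u⁻¹)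
        (fun s s' h => by
          rw [QuotientGroup.rightRel_apply] at h ⊢
          simpa [mul_assoc] using h) q) ?_ ?_
    · refine ⟨?_, ?_, ?_⟩
      · rintro q ⟨b, hb, rfl⟩
        exact ⟨b * u⁻¹, U.mul_mem hb (U.inv_mem hu),
          congrArg (Quotient.mk _) (mul_assoc x b u⁻¹)⟩
      · rintro ⟨s⟩ - ⟨s'⟩ - h
        have h := QuotientGroup.rightRel_apply.1 (Quotient.exact h)
        exact Quotient.sound (QuotientGroup.rightRel_apply.2 (by simpa [mul_assoc] using h))
      · rintro q ⟨b, hb, rfl⟩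
        exact ⟨Quotient.mk _ (x * (b * u)), ⟨b * u, U.mul_mem hb hu, rfl⟩,
          congrArg (Quotient.mk _) (show x * (b * u) * u⁻¹ = x * b by group)⟩
    · intro q hq
      obtain ⟨a, ha, b, hb, hab⟩ := out_mem hq
      have hs : ∃ a' ∈ U, ∃ b' ∈ U, q.out * u⁻¹ = a' * x * b' :=
        ⟨a, ha, b * u⁻¹, U.mul_mem hb (U.inv_mem hu), by rw [hab]; group⟩
      have hmk : Quotient.mk (QuotientGroup.rightRel U) (q.out * u⁻¹) =
          Quotient.mk _ (Quotient.map' (s₂ := QuotientGroup.rightRel U) (fun s => s * u⁻¹)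
        (fun s s' h => by
          rw [QuotientGroup.rightRel_apply] at h ⊢
          simpa [mul_assoc] using h) q).out := by
        rw [Quotient.out_eq]
        conv_rhs => rw [← Quotient.out_eq q]
        rfl
      change _ = act u _
      rw [heckeTerm_eq hop c g τ hs hmk]
      obtain ⟨a', ha', b', hb', hab'⟩ := hs
      have h4 := (hop a' ha' b' hb' u hu).2
      rw [← hab', inv_mul_cancel_right] at h4
      rw [h4, LinearMap.comp_apply]
      congr 4
      group
  · refine ⟨_, isCompact_mulDoubleCoset hC hUc x, fun g τ h => ?_⟩
    obtain ⟨q, hq, hne⟩ := exists_ne_zero_of_finsum_mem_ne_zero h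
    obtain ⟨a, ha, b, hb, hab⟩ := out_mem hq
    obtain ⟨γ, u, t, hu, ht⟩ := h3 (g * q.out⁻¹) τ fun h0 => hne (by simp [h0])
    refine ⟨γ, 1, t, one_mem _, ((_, u⁻¹ * a), b), ⟨⟨ht, U.mul_mem (U.inv_mem hu) ha⟩, hb⟩, ?_⟩
    ext1
    · change toGLf γ * (g * q.out⁻¹) * u * (u⁻¹ * a) * x * b = toGLf γ * g * 1
      rw [hab]; group
    · rfl

/-- The Hecke operator of the double coset `U x U`, on cochains. -/
def heckeCochain (hUo : IsOpen (U : Set (GLf F))) (hUc : IsCompact (U : Set (GLf F)))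
    (x : GLf F) (op : GLf F → E →ₗ[R] E) (hop : HeckeCompat U act x op) (k : ℕ) :
    Cochain U act k →ₗ[R] Cochain U act k where
  toFun c := ⟨heckeFun U x op c.1, heckeFun_mem hUo hUc hop c⟩
  map_add' c c' := by
    apply Subtype.ext; funext g τ
    change ∑ᶠ q ∈ doubleCosets U x, op q.out (c.1 (g * q.out⁻¹) τ + c'.1 (g * q.out⁻¹) τ) =
      ∑ᶠ q ∈ doubleCosets U x, op q.out (c.1 (g * q.out⁻¹) τ) +
        ∑ᶠ q ∈ doubleCosets U x, op q.out (c'.1 (g * q.out⁻¹) τ)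
    simp only [map_add]
    exact finsum_mem_add_distrib (finite_doubleCosets hUo hUc x)
  map_smul' r c := by
    apply Subtype.ext; funext g τ
    change ∑ᶠ q ∈ doubleCosets U x, op q.out (r • c.1 (g * q.out⁻¹) τ) =
      r • ∑ᶠ q ∈ doubleCosets U x, op q.out (c.1 (g * q.out⁻¹) τ)
    simp only [map_smul]
    exact ((DistribSMul.toAddMonoidHom E r).map_finsum_mem _
      (finite_doubleCosets hUo hUc x)).symm

lemma heckeCochain_coboundary (hUo : IsOpen (U : Set (GLf F))) (hUc : IsCompact (U : Set (GLf F)))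
    (x : GLf F) (op : GLf F → E →ₗ[R] E) (hop : HeckeCompat U act x op) (k : ℕ)
    (c : Cochain U act k) :
    heckeCochain hUo hUc x op hop (k + 1) (coboundary U act k c) =
      coboundary U act k (heckeCochain hUo hUc x op hop k c) := by
  apply Subtype.ext; funext g τ
  change ∑ᶠ q ∈ doubleCosets U x,
      op q.out (∑ i : Fin (k + 2), (-1 : R) ^ (i : ℕ) • c.1 (g * q.out⁻¹) (face i τ)) =
    ∑ i : Fin (k + 2), (-1 : R) ^ (i : ℕ) •
      ∑ᶠ q ∈ doubleCosets U x, op q.out (c.1 (g * q.out⁻¹) (face i τ))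
  have hfin := finite_doubleCosets hUo hUc x
  simp only [finsum_mem_eq_finite_toFinset_sum _ hfin, map_sum, map_smul, Finset.smul_sum]
  exact Finset.sum_comm

/-- The Hecke operator of the double coset `U x U` on `H^k_cpt(X_U, ℰ)`, where `s ∈ U x U`
operates on the coefficients by `op s`. -/
def hecke (hUo : IsOpen (U : Set (GLf F))) (hUc : IsCompact (U : Set (GLf F)))
    (x : GLf F) (op : GLf F → E →ₗ[R] E) (hop : HeckeCompat U act x op) (k : ℕ) :
    Hcpt U act k →ₗ[R] Hcpt U act k :=
  Hcpt.map (heckeCochain hUo hUc x op hop) (heckeCochain_coboundary hUo hUc x op hop) k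

end Cohomology

section Measures

variable (F : Type*) [Field F] [NumberField F] (p : ℕ)

/-- The tame level: an ideal `𝔫 ≠ 0` prime to `p` and an open compact subgroup `S` of `GL₂(F̂)`
with `U₁(𝔫) ⊆ S ⊆ U₀(𝔫)` (so that the `p`-component of `S` is `GL₂(𝔯_p)`), such that the groups
`Γ / (Γ ∩ F^×)` are torsion-free, where `Γ = g S g⁻¹ ∩ GL₂⁺(F)` and `g ∈ GL₂(F̂)`. -/
structure TameLevel where
  /-- the ideal `𝔫` -/
  cond : Ideal (𝓞 F)
  cond_ne_bot : cond ≠ ⊥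
  cond_coprime : IsCoprime (Ideal.span {(p : 𝓞 F)}) cond
  /-- the group `S` -/
  S : Subgroup (GLf F)
  isOpen : IsOpen (S : Set (GLf F))
  isCompact : IsCompact (S : Set (GLf F))
  U1_le : U1 cond ≤ S
  le_U0 : S ≤ U0 cond
  torsionFree : ∀ (g : GLf F) (γ : GL (Fin 2) F),
    (∀ σ : F →+* ℝ, 0 < σ (γ.det : Fˣ)) → g⁻¹ * toGLf γ * g ∈ S →
    ∀ k : ℕ, 0 < k → γ ^ k ∈ (Matrix.GeneralLinearGroup.scalar (R := F) (Fin 2)).range →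
      γ ∈ (Matrix.GeneralLinearGroup.scalar (R := F) (Fin 2)).range

variable {F p} (S : TameLevel F p)

lemma TameLevel.le_U0_top : S.S ≤ U0 (⊤ : Ideal (𝓞 F)) := S.le_U0.trans (U0_mono le_top)

/-- The image of `𝔢 = S ∩ F^×` in `𝔯_p^×`. -/
def TameLevel.unitsE : Subgroup (Rp F p)ˣ where
  carrier := {z | ∃ e : Fˣ, toGLf (Matrix.GeneralLinearGroup.scalar (Fin 2) e) ∈ S.S ∧
    ∀ w : PlaceAbove F p, (((z : Rp F p) w : w.1.adicCompletionIntegers F) : w.1.adicCompletion F) =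
      algebraMap F (w.1.adicCompletion F) e}
  one_mem' := ⟨1, by simp, fun w => by simp⟩
  mul_mem' := by
    rintro z z' ⟨e, he, h⟩ ⟨e', he', h'⟩
    exact ⟨e * e', by simpa using S.S.mul_mem he he', fun w => by simp [h w, h' w]⟩
  inv_mem' := by
    rintro z ⟨e, he, h⟩
    refine ⟨e⁻¹, by simpa using S.S.inv_mem he, fun w => ?_⟩
    have h1 : (((z : Rp F p) w : w.1.adicCompletionIntegers F) : w.1.adicCompletion F) *
        ((((z⁻¹ : (Rp F p)ˣ) : Rp F p) w : w.1.adicCompletionIntegers F) :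
          w.1.adicCompletion F) = 1 := by
      rw [← MulMemClass.coe_mul, ← Pi.mul_apply, Units.mul_inv]
      rfl
    rw [h w] at h1
    rw [Units.val_inv_eq_inv_val, map_inv₀]
    exact eq_inv_of_mul_eq_one_right h1

/-- The closure `ē` of `𝔢 = S ∩ F^×` in `𝔯_p^×`. -/
def TameLevel.ebar : Subgroup (Rp F p)ˣ := S.unitsE.topologicalClosure

/-- The condition that `((x, y), z)` lies in `(𝔯_p²)' × 𝔯_p^×`, where `(𝔯_p²)'` is the set of the
primitive vectors. -/
def InX (η : Rp F p × Rp F p × Rp F p) : Prop :=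
  (∀ w, IsUnit (η.1 w) ∨ IsUnit (η.2.1 w)) ∧ IsUnit η.2.2

/-- The operation `e · ((x, y), z) = ((e x, e y), e² z)`. -/
def scaleX (e : Rp F p) (η : Rp F p × Rp F p × Rp F p) : Rp F p × Rp F p × Rp F p :=
  (e * η.1, e * η.2.1, e ^ 2 * η.2.2)

lemma inX_scale (e : (Rp F p)ˣ) (η : Rp F p × Rp F p × Rp F p) :
    InX (scaleX (e : Rp F p) η) ↔ InX η := by
  have he : ∀ w, IsUnit ((e : Rp F p) w) := fun w => (Pi.isUnit_iff.1 e.isUnit) w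
  simp [InX, scaleX, he]

/-- The space `X = ē \ ((𝔯_p²)' × 𝔯_p^×)`, identified with `NC \ GL₂(𝔯_p)` by
`(a, b; c, d) ↦ ((a, b), ad - bc)`. -/
def TameLevel.setoidX : Setoid {η : Rp F p × Rp F p × Rp F p // InX η} where
  r η η' := ∃ e ∈ S.ebar, η'.1 = scaleX (e : Rp F p) η.1
  iseqv :=
    { refl := fun η => ⟨1, one_mem _, by simp [scaleX]⟩
      symm := by
        rintro η η' ⟨e, he, h⟩
        refine ⟨e⁻¹, inv_mem he, ?_⟩
        rw [h]
        ext1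
        · simp [scaleX]
        · ext1 <;> simp [scaleX, ← mul_assoc, ← mul_pow]
      trans := by
        rintro η η' η'' ⟨e, he, h⟩ ⟨e', he', h'⟩
        refine ⟨e' * e, mul_mem he' he, ?_⟩
        rw [h', h]
        simp [scaleX, mul_assoc, mul_pow] }

/-- The space `X = ē \ ((𝔯_p²)' × 𝔯_p^×)`, identified with `NC \ GL₂(𝔯_p)` by
`(a, b; c, d) ↦ ((a, b), ad - bc)`; it carries the quotient topology. -/
abbrev TameLevel.X : Type _ := Quotient S.setoidX

variable {K : Type*} [NormedField K] [IsUltrametricDist K]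

/-- A continuous function on `X`, as a function on all triples, extended by zero. -/
def extendX (φ : C(S.X, OK K)) (η : Rp F p × Rp F p × Rp F p) : OK K :=
  open Classical in if h : InX η then φ (Quotient.mk S.setoidX ⟨η, h⟩) else 0

lemma extendX_scale (φ : C(S.X, OK K)) {e : (Rp F p)ˣ} (he : e ∈ S.ebar)
    (η : Rp F p × Rp F p × Rp F p) : extendX S φ (scaleX (e : Rp F p) η) = extendX S φ η := by
  by_cases h : InX η
  · have h' : InX (scaleX (e : Rp F p) η) := (inX_scale e η).2 h
    simp only [extendX, h, h', dif_pos]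
    congr 1
    exact (Quotient.sound (s := S.setoidX) ⟨e, he, rfl⟩).symm
  · have h' : ¬ InX (scaleX (e : Rp F p) η) := fun h2 => h ((inX_scale e η).1 h2)
    simp only [extendX, h, h', dif_neg, not_false_eq_true]

lemma finite_placeAbove [Fact p.Prime] : Finite (PlaceAbove F p) := by
  have h0 : Ideal.span {(p : 𝓞 F)} ≠ 0 := by
    simpa using (Fact.out : p.Prime).ne_zero
  refine (Set.Finite.subset (Ideal.finite_factors h0) ?_).to_subtype
  intro w hw
  exact Ideal.dvd_span_singleton.2 hw

lemma isClopen_isUnit (w : HeightOneSpectrum (𝓞 F)) :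
    IsClopen {x : w.adicCompletionIntegers F | IsUnit x} := by
  have h := Valued.isClopen_sphere (w.adicCompletion F) (Γ₀ := WithZero (Multiplicative ℤ))
    (r := 1) one_ne_zero
  have h2 := h.preimage (f := fun x : w.adicCompletionIntegers F => (x : w.adicCompletion F))
    continuous_subtype_val
  convert h2 using 1
  ext x
  simp only [Set.mem_ofPred_eq, Set.mem_preimage, Valuation.restrict_eq_one_iff]
  exact adicCompletionIntegers.isUnit_iff_valued_eq_one

lemma isClopen_inX [Fact p.Prime] : IsClopen {η : Rp F p × Rp F p × Rp F p | InX η} := by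
  have := finite_placeAbove (F := F) (p := p)
  have h1 : ∀ w : PlaceAbove F p, IsClopen {η : Rp F p × Rp F p × Rp F p |
      IsUnit (η.1 w) ∨ IsUnit (η.2.1 w)} := fun w =>
    ((isClopen_isUnit w.1).preimage (f := fun η : Rp F p × Rp F p × Rp F p => η.1 w)
      (by fun_prop)).union
    ((isClopen_isUnit w.1).preimage (f := fun η : Rp F p × Rp F p × Rp F p => η.2.1 w)
      (by fun_prop))
  have h2 : ∀ w : PlaceAbove F p, IsClopen {η : Rp F p × Rp F p × Rp F p |
      IsUnit (η.2.2 w)} := fun w =>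
    ((isClopen_isUnit w.1).preimage (f := fun η : Rp F p × Rp F p × Rp F p => η.2.2 w)
      (by fun_prop))
  have h3 := (isClopen_iInter_of_finite h1).inter (isClopen_iInter_of_finite h2)
  convert h3 using 1
  ext η
  simp [InX, Pi.isUnit_iff]

lemma continuous_extendX [Fact p.Prime] (φ : C(S.X, OK K)) : Continuous (extendX S φ) := by
  rw [continuous_iff_continuousAt]
  intro η
  by_cases h : InX η
  · have hopen : IsOpen {η : Rp F p × Rp F p × Rp F p | InX η} := isClopen_inX.isOpen
    have he := hopen.isOpenEmbedding_subtypeVal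
    rw [show η = ((⟨η, h⟩ : {η : Rp F p × Rp F p × Rp F p | InX η}) :
      Rp F p × Rp F p × Rp F p) from rfl, ← he.continuousAt_iff]
    have hfun : (extendX S φ ∘ Subtype.val : {η : Rp F p × Rp F p × Rp F p | InX η} → OK K) =
        fun η => φ (Quotient.mk S.setoidX η) := by
      funext η
      have : InX η.1 := η.2
      simp [extendX, this]
    rw [hfun]
    exact ((map_continuous φ).comp continuous_quotient_mk').continuousAt
  · have hopen : IsOpen {η : Rp F p × Rp F p × Rp F p | InX η}ᶜ := isClopen_inX.compl.isOpen
    refine ContinuousAt.congr (f := fun _ => (0 : OK K)) continuousAt_const ?_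
    filter_upwards [hopen.mem_nhds h] with η' h'
    have : ¬ InX η' := h'
    simp [extendX, this]

variable (p) in
/-- The element `∏ π_𝔭^{-c(𝔭)} det s` of `𝔯_p`, where `c(𝔭)` is the valuation of `det s` at `𝔭`
and `p` serves as the uniformizer at all the `𝔭 ∣ p`; note that `WithZero.log` of the value of an
element of valuation `c` is `-c`. -/
def unitPart (s : GLf F) : Rp F p := fun w =>
  toInt w.1 (evalAt w.1 (s.det : (FiniteAdeleRing (𝓞 F) F)ˣ) *
    (p : w.1.adicCompletion F) ^
      WithZero.log (Valued.v (evalAt w.1 (s.det : (FiniteAdeleRing (𝓞 F) F)ˣ))))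

variable (p) in
/-- The `*`-operation `((x, y), z) * s = ((x, y) s, z · ∏ π_𝔭^{-c(𝔭)} det s)` of matrices that are
integral at `p`. -/
def starX (s : GLf F) (η : Rp F p × Rp F p × Rp F p) : Rp F p × Rp F p × Rp F p :=
  (η.1 * pMat p s 0 0 + η.2.1 * pMat p s 1 0, η.1 * pMat p s 0 1 + η.2.1 * pMat p s 1 1,
    η.2.2 * unitPart p s)

lemma starX_scale (s : GLf F) (e : Rp F p) (η : Rp F p × Rp F p × Rp F p) :
    starX p s (scaleX e η) = scaleX e (starX p s η) := by
  simp only [starX, scaleX, mul_add, mul_assoc]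

lemma evalAt_det {s : GLf F} (hs : s ∈ Delta0 (⊤ : Ideal (𝓞 F))) (w : PlaceAbove F p) :
    evalAt w.1 (s.det : (FiniteAdeleRing (𝓞 F) F)ˣ) =
      (((pMat p s).det w : w.1.adicCompletionIntegers F) : w.1.adicCompletion F) := by
  rw [Matrix.det_fin_two, Matrix.GeneralLinearGroup.val_det_apply, Matrix.det_fin_two]
  simp only [Pi.sub_apply, Pi.mul_apply, AddSubgroupClass.coe_sub, MulMemClass.coe_mul,
    pMat_coe p hs]
  rfl

lemma valued_det_unit {u : GLf F} (hu : u ∈ U0 (⊤ : Ideal (𝓞 F))) (w : PlaceAbove F p) :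
    Valued.v (evalAt w.1 (u.det : (FiniteAdeleRing (𝓞 F) F)ˣ)) = 1 := by
  rw [evalAt_det (U0_le_Delta0 _ u hu)]
  exact adicCompletionIntegers.isUnit_iff_valued_eq_one.1
    (Pi.isUnit_iff.1 (isUnit_det_pMat p hu) w)

lemma unitPart_mul_unit (s : GLf F) {u : GLf F} (hu : u ∈ U0 (⊤ : Ideal (𝓞 F))) :
    unitPart p (s * u) = unitPart p s * (pMat p u).det := by
  funext w
  have h1 : IsUnit ((pMat p u).det w) := Pi.isUnit_iff.1 (isUnit_det_pMat p hu) w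
  obtain ⟨v, hv⟩ := h1
  rw [Pi.mul_apply, ← hv, unitPart, unitPart, ← toInt_mul_unit]
  congr 1
  rw [map_mul, Units.val_mul, map_mul, map_mul, valued_det_unit hu w, mul_one,
    evalAt_det (U0_le_Delta0 _ u hu), ← hv]
  ring

lemma unitPart_unit_mul (s : GLf F) {u : GLf F} (hu : u ∈ U0 (⊤ : Ideal (𝓞 F))) :
    unitPart p (u * s) = (pMat p u).det * unitPart p s := by
  rw [mul_comm, ← unitPart_mul_unit s hu]
  funext w
  simp only [unitPart, map_mul, mul_comm]

lemma unitPart_unit {u : GLf F} (hu : u ∈ U0 (⊤ : Ideal (𝓞 F))) :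
    unitPart p u = (pMat p u).det := by
  have h := unitPart_mul_unit (p := p) 1 hu
  rw [one_mul] at h
  rw [h]
  have h1 : unitPart p (1 : GLf F) = 1 := by
    funext w
    have : (1 : w.1.adicCompletion F) = ((1 : w.1.adicCompletionIntegers F) : w.1.adicCompletion F) :=
      rfl
    simp only [unitPart, map_one, Units.val_one, WithZero.log_one, zpow_zero, mul_one, Pi.one_apply]
    rw [this, toInt_coe]
  rw [h1, one_mul]

lemma starX_mul_unit {s u : GLf F} (hs : s ∈ Delta0 (⊤ : Ideal (𝓞 F)))
    (hu : u ∈ U0 (⊤ : Ideal (𝓞 F))) (η : Rp F p × Rp F p × Rp F p) :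
    starX p (s * u) η = starX p u (starX p s η) := by
  simp only [starX, unitPart_mul_unit s hu, unitPart_unit hu, pMat_mul p hs (U0_le_Delta0 _ u hu),
    Matrix.mul_apply, Fin.sum_univ_two]
  ext1
  · dsimp only; ring
  · ext1 <;> dsimp only <;> ring

lemma starX_unit_mul {s u : GLf F} (hs : s ∈ Delta0 (⊤ : Ideal (𝓞 F)))
    (hu : u ∈ U0 (⊤ : Ideal (𝓞 F))) (η : Rp F p × Rp F p × Rp F p) :
    starX p (u * s) η = starX p s (starX p u η) := by
  simp only [starX, unitPart_unit_mul s hu, unitPart_unit hu, pMat_mul p (U0_le_Delta0 _ u hu) hs,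
    Matrix.mul_apply, Fin.sum_univ_two]
  ext1
  · dsimp only; ring
  · ext1 <;> dsimp only <;> ring

lemma starX_one (η : Rp F p × Rp F p × Rp F p) : starX p (1 : GLf F) η = η := by
  have h := unitPart_unit (p := p) (U0 (⊤ : Ideal (𝓞 F))).one_mem
  simp [starX, h]

lemma inX_starX_unit {u : GLf F} (hu : u ∈ U0 (⊤ : Ideal (𝓞 F)))
    (η : Rp F p × Rp F p × Rp F p) : InX (starX p u η) ↔ InX η := by
  have key : ∀ {u : GLf F}, u ∈ U0 (⊤ : Ideal (𝓞 F)) → ∀ η : Rp F p × Rp F p × Rp F p,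
      InX η → InX (starX p u η) := by
    intro u hu η hη
    refine ⟨fun w => ?_, ?_⟩
    · by_contra! hcon
      have hdet : pMat p u * pMat p u⁻¹ = 1 := by
        rw [← pMat_mul p (U0_le_Delta0 _ u hu) (U0_le_Delta0 _ _ (inv_mem hu)), mul_inv_cancel,
          pMat_one]
      have hstar : starX p u⁻¹ (starX p u η) = η := by
        rw [← starX_mul_unit (U0_le_Delta0 _ u hu) (inv_mem hu), mul_inv_cancel, starX_one]
      have hm1 : (starX p u η).1 w ∈ IsLocalRing.maximalIdeal (w.1.adicCompletionIntegers F) :=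
        hcon.1
      have hm2 : (starX p u η).2.1 w ∈ IsLocalRing.maximalIdeal (w.1.adicCompletionIntegers F) :=
        hcon.2
      have e1 : η.1 w = (starX p u η).1 w * pMat p u⁻¹ 0 0 w +
          (starX p u η).2.1 w * pMat p u⁻¹ 1 0 w := by
        conv_lhs => rw [← hstar]
        rfl
      have e2 : η.2.1 w = (starX p u η).1 w * pMat p u⁻¹ 0 1 w +
          (starX p u η).2.1 w * pMat p u⁻¹ 1 1 w := by
        conv_lhs => rw [← hstar]
        rfl
      rcases hη.1 w with h | h
      · rw [e1] at h
        exact (Ideal.add_mem _ (Ideal.mul_mem_right _ _ hm1) (Ideal.mul_mem_right _ _ hm2) :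
          _ ∈ IsLocalRing.maximalIdeal (w.1.adicCompletionIntegers F)) h
      · rw [e2] at h
        exact (Ideal.add_mem _ (Ideal.mul_mem_right _ _ hm1) (Ideal.mul_mem_right _ _ hm2) :
          _ ∈ IsLocalRing.maximalIdeal (w.1.adicCompletionIntegers F)) h
    · change IsUnit (η.2.2 * unitPart p u)
      rw [unitPart_unit hu]
      exact hη.2.mul (isUnit_det_pMat p hu)
  refine ⟨fun h => ?_, key hu η⟩
  have := key (inv_mem hu) _ h
  rwa [← starX_mul_unit (U0_le_Delta0 _ u hu) (inv_mem hu), mul_inv_cancel, starX_one] at this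

lemma continuous_rowMul {A : Type*} [CommRing A] [TopologicalSpace A] [IsTopologicalRing A]
    (a b c d e : A) : Continuous fun η : A × A × A =>
      (η.1 * a + η.2.1 * c, η.1 * b + η.2.1 * d, η.2.2 * e) := by
  fun_prop

lemma continuous_starX (s : GLf F) : Continuous (starX p s) :=
  continuous_rowMul (pMat p s 0 0) (pMat p s 0 1) (pMat p s 1 0) (pMat p s 1 1) (unitPart p s)

lemma extendX_add (φ ψ : C(S.X, OK K)) (η : Rp F p × Rp F p × Rp F p) :
    extendX S (φ + ψ) η = extendX S φ η + extendX S ψ η := by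
  by_cases h : InX η
  · simp only [extendX, h, dif_pos, ContinuousMap.add_apply]
  · simp only [extendX, h, dif_neg, not_false_eq_true, add_zero]

lemma extendX_smul (r : OK K) (φ : C(S.X, OK K)) (η : Rp F p × Rp F p × Rp F p) :
    extendX S (r • φ) η = r • extendX S φ η := by
  by_cases h : InX η
  · simp only [extendX, h, dif_pos, ContinuousMap.smul_apply]
  · simp only [extendX, h, dif_neg, not_false_eq_true, smul_zero]

/-- The function `η ↦ φ(η * s)` on `X`, with the value `0` at the `η` for which `η * s` does not
lie in `X`. -/
def pullFun [Fact p.Prime] (s : GLf F) (φ : C(S.X, OK K)) : C(S.X, OK K) :=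
  ⟨Quotient.lift (fun η => extendX S φ (starX p s η.1)) (by
      rintro η η' ⟨e, he, h⟩
      rw [h, starX_scale, extendX_scale S φ he]),
    Continuous.quotient_lift
      ((continuous_extendX S φ).comp ((continuous_starX s).comp continuous_subtype_val)) _⟩

/-- `φ ↦ (η ↦ φ(η * s))` as a linear map. -/
def pull [Fact p.Prime] (s : GLf F) : C(S.X, OK K) →ₗ[OK K] C(S.X, OK K) where
  toFun φ := pullFun S s φ
  map_add' φ ψ := by
    apply ContinuousMap.ext
    rintro ⟨η⟩
    exact extendX_add S φ ψ (starX p s η.1)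
  map_smul' r φ := by
    apply ContinuousMap.ext
    rintro ⟨η⟩
    exact extendX_smul S r φ (starX p s η.1)

lemma extendX_pull [Fact p.Prime] (s : GLf F) (φ : C(S.X, OK K)) {η : Rp F p × Rp F p × Rp F p}
    (h : InX η) : extendX S (pull S s φ) η = extendX S φ (starX p s η) := by
  simp only [extendX, h, dif_pos]
  rfl

variable (K) in
/-- The module `𝔻_X` of `𝒪`-valued measures on `X`, as the `𝒪`-dual of the space of continuous
functions `C(X, 𝒪)`. (An `𝒪`-linear functional `λ` is automatically continuous, since
`λ(p^n C(X, 𝒪)) ⊆ p^n 𝒪`.) -/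
abbrev Meas : Type _ := C(S.X, OK K) →ₗ[OK K] OK K

/-- The operation `μ ↦ μ * s` on `𝔻_X`:
`∫_X φ(η) d(μ * s)(η)` is the integral of `φ(η * s)` over the `η ∈ X` with `η * s ∈ X`. -/
def measAct [Fact p.Prime] (s : GLf F) : Meas S K →ₗ[OK K] Meas S K := LinearMap.lcomp _ _ (pull S s)

lemma measAct_apply [Fact p.Prime] (s : GLf F) (μ : Meas S K) (φ : C(S.X, OK K)) :
    measAct S s μ φ = μ (pull S s φ) := rfl

lemma measAct_compat [Fact p.Prime] {x : GLf F} (hx : x ∈ Delta0 (⊤ : Ideal (𝓞 F))) :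
    HeckeCompat S.S (measAct S (K := K)) x (measAct S) := by
  intro a ha b hb u hu
  have hs : a * x * b ∈ Delta0 (⊤ : Ideal (𝓞 F)) :=
    mul_mem (mul_mem (U0_le_Delta0 _ _ (S.le_U0_top ha)) hx) (U0_le_Delta0 _ _ (S.le_U0_top hb))
  have hu' := S.le_U0_top hu
  constructor
  · refine LinearMap.ext fun μ => LinearMap.ext fun φ => ?_
    rw [LinearMap.comp_apply, measAct_apply, measAct_apply, measAct_apply]
    congr 1
    apply ContinuousMap.ext
    rintro ⟨η⟩
    change extendX S φ (starX p _ η.1) = extendX S (pull S _ φ) (starX p u η.1)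
    rw [extendX_pull S _ φ ((inX_starX_unit hu' _).2 η.2), starX_unit_mul hs hu']
  · refine LinearMap.ext fun μ => LinearMap.ext fun φ => ?_
    rw [LinearMap.comp_apply, measAct_apply, measAct_apply, measAct_apply]
    congr 1
    apply ContinuousMap.ext
    rintro ⟨η⟩
    change extendX S φ (starX p _ η.1) = extendX S (pull S u φ) (starX p (a * x * b) η.1)
    rw [starX_mul_unit hs hu']
    by_cases h : InX (starX p (a * x * b) η.1)
    · rw [extendX_pull S _ φ h]
    · have h' : ¬ InX (starX p u (starX p (a * x * b) η.1)) := fun h2 =>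
        h ((inX_starX_unit hu' _).1 h2)
      simp only [extendX, h, h', dif_neg, not_false_eq_true]

end Measures

section Specialization

variable {F : Type*} [Field F] [NumberField F] {p : ℕ} [Fact p.Prime]
variable (S : TameLevel F p)
variable (K : Type*) [NormedField K] [IsUltrametricDist K] [CharZero K] [NormedAlgebra ℚ_[p] K]
  [FiniteDimensional ℚ_[p] K]

/-- The data of an arithmetic point `κ` that enter in its specialization map: a weight `(n, v)`
with `n ≥ 0` and `n + 2v = m t` parallel, an exponent `α ≥ 1`, and a character `ε` of
`(𝔯_p / p^α)^×` (extended by zero) such that `ε χ_cyc^m`, with `χ_cyc(z) = ∏_σ σ(z)`, factors through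
`𝔯_p^× / ē`. -/
structure ArithWeight where
  n : (F →+* K) → ℕ
  v : (F →+* K) → ℤ
  m : ℤ
  parallel : ∀ σ, (n σ : ℤ) + 2 * v σ = m
  α : ℕ
  one_le_α : 1 ≤ α
  ε : MulChar (Rp F p ⧸ Ideal.span {(p : Rp F p) ^ α}) (OK K)
  trivial_on_ebar : ∀ e ∈ S.ebar,
    ((ε (Ideal.Quotient.mk _ (e : Rp F p)) : OK K) : K) *
      ∏ σ : F →+* K, ((embO p σ (e : Rp F p) : OK K) : K) ^ m = 1

variable {S K}

namespace ArithWeight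

variable (κ : ArithWeight S K)

/-- The value `ε(x)`, for `x ∈ 𝔯_p`; it is zero if `x` is not a unit. -/
def eps (x : Rp F p) : OK K := κ.ε (Ideal.Quotient.mk _ x)

/-- `z^v = ∏_σ σ(z)^{v_σ}`, in `K`. -/
def powV (z : Rp F p) : K := ∏ σ : F →+* K, ((embO p σ z : OK K) : K) ^ κ.v σ

lemma powV_mul (z z' : Rp F p) : κ.powV (z * z') = κ.powV z * κ.powV z' := by
  simp only [powV, map_mul, Subring.coe_mul, mul_zpow, Finset.prod_mul_distrib]

lemma norm_powV {z : Rp F p} (hz : IsUnit z) : ‖κ.powV z‖ = 1 := by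
  simp [powV, norm_embO_unit p _ hz]

lemma eps_mul (x y : Rp F p) : κ.eps (x * y) = κ.eps x * κ.eps y := by
  simp [eps]

lemma eps_add {x y : Rp F p} (hy : y ∈ Ideal.span {(p : Rp F p) ^ κ.α}) :
    κ.eps (x + y) = κ.eps x := by
  rw [eps, map_add, Ideal.Quotient.eq_zero_iff_mem.2 hy, add_zero, eps]

/-- The weights of the variables: `X_σ` (the variable `(σ, 0)`) and `Y_σ` (the variable `(σ, 1)`)
have degree `1` in the coordinate `σ`. -/
def wt (i : (F →+* K) × Fin 2) : (F →+* K) → ℕ := open Classical in Pi.single i.1 1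

/-- The module `L(n, 𝒪)` of polynomials in the variables `X_σ` (the variable `(σ, 0)`) and `Y_σ`
(the variable `(σ, 1)`) over `𝒪` that are homogeneous of degree `n_σ` in `X_σ, Y_σ`. -/
abbrev L : Submodule (OK K) (MvPolynomial ((F →+* K) × Fin 2) (OK K)) :=
  weightedHomogeneousSubmodule (OK K) wt κ.n

/-- The substitution `P(X, Y) ↦ P((X, Y) M*)`, where `M* = (d, -b; -c, a)` for
`M = (a, b; c, d)`. -/
def subst (K : Type*) [NormedField K] [IsUltrametricDist K] [NormedAlgebra ℚ_[p] K]
    [FiniteDimensional ℚ_[p] K] (M : Matrix (Fin 2) (Fin 2) (Rp F p)) :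
    MvPolynomial ((F →+* K) × Fin 2) (OK K) →ₐ[OK K] MvPolynomial ((F →+* K) × Fin 2) (OK K) :=
  aeval fun i : (F →+* K) × Fin 2 =>
    ![C (embO p i.1 (M 1 1)) * X (i.1, 0) - C (embO p i.1 (M 1 0)) * X (i.1, 1),
      -C (embO p i.1 (M 0 1)) * X (i.1, 0) + C (embO p i.1 (M 0 0)) * X (i.1, 1)] i.2

lemma subst_mul (M N : Matrix (Fin 2) (Fin 2) (Rp F p)) :
    subst K (M * N) = (subst K N).comp (subst K M) := by
  refine MvPolynomial.algHom_ext fun ⟨σ, i⟩ => ?_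
  fin_cases i
  · simp [subst, Matrix.mul_apply, Fin.sum_univ_two]
    ring
  · simp [subst, Matrix.mul_apply, Fin.sum_univ_two]
    ring

lemma subst_X_homogeneous (M : Matrix (Fin 2) (Fin 2) (Rp F p)) (i : (F →+* K) × Fin 2) :
    IsWeightedHomogeneous wt (subst K M (X i)) (wt i) := by
  obtain ⟨σ, i⟩ := i
  have h0 : IsWeightedHomogeneous wt (X (σ, 0) : MvPolynomial ((F →+* K) × Fin 2) (OK K))
    (wt (σ, i)) := isWeightedHomogeneous_X (OK K) wt (σ, 0)
  have h1 : IsWeightedHomogeneous wt (X (σ, 1) : MvPolynomial ((F →+* K) × Fin 2) (OK K))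
    (wt (σ, i)) := isWeightedHomogeneous_X (OK K) wt (σ, 1)
  rw [subst, aeval_X]
  fin_cases i
  · exact (h0.C_mul _).sub (h1.C_mul _)
  · refine IsWeightedHomogeneous.add ?_ (h1.C_mul _)
    have h2 := h0.C_mul (-(embO p σ (M 0 1)))
    rw [map_neg] at h2
    exact h2

lemma subst_mem (M : Matrix (Fin 2) (Fin 2) (Rp F p))
    {P : MvPolynomial ((F →+* K) × Fin 2) (OK K)} (hP : P ∈ κ.L) : subst K M P ∈ κ.L := by
  rw [P.as_sum, map_sum]
  refine Submodule.sum_mem _ fun m hm => ?_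
  have hw : Finsupp.weight wt m = κ.n := hP (mem_support_iff.1 hm)
  rw [mem_weightedHomogeneousSubmodule, monomial_eq, map_mul, Finsupp.prod, map_prod, ← hw,
    Finsupp.weight_apply, Finsupp.sum, ← algebraMap_eq, AlgHom.commutes, algebraMap_eq]
  refine IsWeightedHomogeneous.C_mul (IsWeightedHomogeneous.prod _ _ _ fun i _ => ?_) _
  rw [map_pow]
  exact (subst_X_homogeneous M i).pow _

/-- The operation `t · P|_ε s` of `s` on `L(n, v, ε, 𝒪)` multiplied by `t ∈ K`:
`(t · P|_ε s)(X, Y) = t · ε(a) · det(s)^v · P((X, Y) s*)`, where `a` is the upper left entry of `s`.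
For `t = 1` this is the operation on `L(n, v, ε, 𝒪)`. -/
def slash (t : K) (s : GLf F) : κ.L →ₗ[OK K] κ.L :=
  (κ.eps (pMat p s 0 0) * toO (t * κ.powV (pMat p s).det)) •
    ((subst K (pMat p s)).toLinearMap.restrict fun _ hP => κ.subst_mem (pMat p s) hP)

lemma pMat_mem_span {F : Type*} [Field F] [NumberField F] {p : ℕ} {α : ℕ} {s : GLf F}
    (hs : s ∈ Delta0 (Ideal.span {(p : 𝓞 F) ^ α})) :
    pMat p s 1 0 ∈ Ideal.span {(p : Rp F p) ^ α} := by
  have h : ∀ w : PlaceAbove F p, (p : w.1.adicCompletionIntegers F) ^ α ∣ pMat p s 1 0 w := by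
    intro w
    obtain ⟨M, hM, hM'⟩ := hs w.1
    have : pMat p s 1 0 w = M 1 0 := by
      apply Subtype.ext
      rw [pMat_coe p (Delta0_mono le_top hs)]
      exact (congrFun (congrFun hM 1) 0).symm
    rw [this]
    rw [idealAt, Ideal.map_span, Set.image_singleton, Ideal.mem_span_singleton] at hM'
    simpa using hM'
  choose f hf using h
  exact Ideal.mem_span_singleton.2 ⟨f, funext hf⟩

lemma slash_apply (t : K) (s : GLf F) (P : κ.L) : ((κ.slash t s P : κ.L) :
    MvPolynomial ((F →+* K) × Fin 2) (OK K)) =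
      (κ.eps (pMat p s 0 0) * toO (t * κ.powV (pMat p s).det)) • subst K (pMat p s) P := rfl

lemma slash_compat {U : Subgroup (GLf F)} (hU : U ≤ U0 (Ideal.span {(p : 𝓞 F) ^ κ.α})) (t : K)
    {x : GLf F} (hx : x ∈ Delta0 (Ideal.span {(p : 𝓞 F) ^ κ.α})) :
    HeckeCompat (R := OK K) (E := κ.L) U (κ.slash 1) x (κ.slash t) := by
  intro a ha b hb u hu
  have hΔ : ∀ u ∈ U, u ∈ Delta0 (Ideal.span {(p : 𝓞 F) ^ κ.α}) := fun u hu =>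
    U0_le_Delta0 _ u (hU hu)
  have hs : a * x * b ∈ Delta0 (Ideal.span {(p : 𝓞 F) ^ κ.α}) :=
    mul_mem (mul_mem (hΔ a ha) hx) (hΔ b hb)
  have hs' := Delta0_mono le_top hs
  have hu' := Delta0_mono le_top (hΔ u hu)
  have hn : ‖κ.powV (pMat p u).det‖ = 1 := κ.norm_powV (isUnit_det_pMat p (U0_mono le_top (hU hu)))
  generalize a * x * b = s at hs hs' ⊢
  constructor
  · refine LinearMap.ext fun P => Subtype.ext ?_
    rw [LinearMap.comp_apply, slash_apply, slash_apply, slash_apply, pMat_mul p hu' hs', subst_mul,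
      Matrix.det_mul, powV_mul, one_mul, mul_comm (κ.powV _), ← mul_assoc,
      toO_mul_of_norm_eq_one _ _ hn, Matrix.mul_apply, Fin.sum_univ_two,
      κ.eps_add (Ideal.mul_mem_left _ _ (pMat_mem_span hs)), eps_mul, map_smul, smul_smul]
    congr 1
    ring
  · refine LinearMap.ext fun P => Subtype.ext ?_
    rw [LinearMap.comp_apply, slash_apply, slash_apply, slash_apply, pMat_mul p hs' hu', subst_mul,
      Matrix.det_mul, powV_mul, one_mul, ← mul_assoc,
      toO_mul_of_norm_eq_one _ _ hn, Matrix.mul_apply, Fin.sum_univ_two,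
      κ.eps_add (Ideal.mul_mem_left _ _ (pMat_mem_span (hΔ u hu))), eps_mul, map_smul, smul_smul]
    congr 1
    ring

lemma isOpen_span (α : ℕ) {F : Type*} [Field F] [NumberField F] {p : ℕ} [Fact p.Prime] :
    IsOpen ((Ideal.span {(p : Rp F p) ^ α} : Ideal (Rp F p)) : Set (Rp F p)) := by
  have := finite_placeAbove (F := F) (p := p)
  have hp : ∀ w : PlaceAbove F p, (p : w.1.adicCompletion F) ^ α ≠ 0 := fun w =>
    pow_ne_zero _ (by
      rw [← map_natCast (algebraMap F (w.1.adicCompletion F)), Ne, map_eq_zero]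
      exact_mod_cast (Fact.out : p.Prime).ne_zero)
  have h : ∀ w : PlaceAbove F p, IsOpen {y : Rp F p |
      Valued.v ((y w : w.1.adicCompletionIntegers F) : w.1.adicCompletion F) ≤
        Valued.v ((p : w.1.adicCompletion F) ^ α)} := by
    intro w
    have h1 := Valued.isOpen_closedBall (w.1.adicCompletion F) (Γ₀ := WithZero (Multiplicative ℤ))
      (r := Valued.v.restrict ((p : w.1.adicCompletion F) ^ α))
      ((Valuation.ne_zero_iff _).2 (hp w))
    have h2 := h1.preimage (f := fun y : Rp F p =>
      ((y w : w.1.adicCompletionIntegers F) : w.1.adicCompletion F))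
      (continuous_subtype_val.comp (continuous_apply w))
    convert h2 using 1
    ext y
    simp only [Set.mem_ofPred_eq, Set.mem_preimage, Valuation.restrict_le_iff]
  refine AddSubgroup.isOpen_of_mem_nhds
    (Ideal.span {(p : Rp F p) ^ α} : Ideal (Rp F p)).toAddSubgroup (g := 0)
    (Filter.mem_of_superset ((isOpen_iInter_of_finite h).mem_nhds (by simp)) ?_)
  intro y hy
  rw [Set.mem_iInter] at hy
  refine Ideal.mem_span_singleton.2 ⟨fun w => ⟨(y w : w.1.adicCompletion F) /
    (p : w.1.adicCompletion F) ^ α, ?_⟩, ?_⟩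
  · rw [mem_adicCompletionIntegers, map_div₀]
    exact div_le_one_of_le₀ (hy w) zero_le
  · funext w
    apply Subtype.ext
    simp only [Pi.mul_apply, Pi.pow_apply, MulMemClass.coe_mul, SubmonoidClass.coe_pow]
    exact (mul_div_cancel₀ _ (hp w)).symm

lemma continuous_eps : Continuous κ.eps := by
  rw [continuous_iff_continuousAt]
  intro x
  refine ContinuousAt.congr (f := fun _ => κ.eps x) continuousAt_const ?_
  have h : Continuous fun y : Rp F p => y - x := by fun_prop
  filter_upwards [((isOpen_span κ.α).preimage h).mem_nhds (by simp)] with y hy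
  rw [← κ.eps_add (x := x) hy, add_sub_cancel]

lemma continuous_powV : Continuous fun z : {z : Rp F p // IsUnit z} => toO (κ.powV z.1) := by
  have h : (fun z : {z : Rp F p // IsUnit z} => toO (κ.powV z.1)) =
      fun z => ⟨κ.powV z.1, (κ.norm_powV z.2).le⟩ := by
    funext z
    apply Subtype.ext
    rw [coe_toO (κ.norm_powV z.2).le]
  rw [h]
  refine Continuous.subtype_mk ?_ _
  refine continuous_finsetProd _ fun σ _ => Continuous.zpow₀ ?_ _ fun z => Or.inl ?_
  · exact continuous_subtype_val.comp ((continuous_embO p σ).comp continuous_subtype_val)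
  · exact norm_ne_zero_iff.1 (by rw [norm_embO_unit p σ z.2]; exact one_ne_zero)

/-- The polynomial `z^v ε(x) (xY - yX)^n`, as a function of `((x, y), z)`. It vanishes outside
of `X'`, since `ε(x) = 0` if `x` is not a unit. -/
def kerPoly (η : Rp F p × Rp F p × Rp F p) : MvPolynomial ((F →+* K) × Fin 2) (OK K) :=
  (toO (κ.powV η.2.2) * κ.eps η.1) •
    ∏ σ : F →+* K,
      (C (embO p σ η.1) * X (σ, 1) - C (embO p σ η.2.1) * X (σ, 0)) ^ κ.n σ

lemma weight_wt (m : (F →+* K) × Fin 2 →₀ ℕ) (i : (F →+* K) × Fin 2) :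
    m i ≤ Finsupp.weight wt m i.1 := by
  classical
  rw [Finsupp.weight_apply, Finsupp.sum_fintype _ _ (by simp), Finset.sum_apply]
  refine le_trans ?_ (Finset.single_le_sum (f := fun j => (m j • wt j) i.1) (fun _ _ => zero_le)
    (Finset.mem_univ i))
  simp [wt]

lemma kerPoly_mem (η : Rp F p × Rp F p × Rp F p) : κ.kerPoly η ∈ κ.L := by
  classical
  refine Submodule.smul_mem _ _ ?_
  rw [mem_weightedHomogeneousSubmodule]
  have hn : κ.n = ∑ σ : F →+* K, κ.n σ • wt (σ, 0) := by
    funext τ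
    simp [wt, Finset.sum_apply, Pi.single_apply]
  rw [hn]
  refine IsWeightedHomogeneous.prod _ _ _ fun σ _ => ?_
  simp only [← hn]
  refine IsWeightedHomogeneous.pow (IsWeightedHomogeneous.sub ?_ ?_) _
  · exact (isWeightedHomogeneous_X (OK K) wt (σ, 1)).C_mul _
  · exact (isWeightedHomogeneous_X (OK K) wt (σ, 0)).C_mul _

/-- The family of polynomials depends continuously on the parameter. -/
def PolyCont {T : Type*} [TopologicalSpace T]
    (P : T → MvPolynomial ((F →+* K) × Fin 2) (OK K)) : Prop :=
  ∀ m, Continuous fun t => coeff m (P t)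

lemma PolyCont.mul {T : Type*} [TopologicalSpace T]
    {P Q : T → MvPolynomial ((F →+* K) × Fin 2) (OK K)} (hP : PolyCont P) (hQ : PolyCont Q) :
    PolyCont fun t => P t * Q t := by
  classical
  intro m
  simp only [coeff_mul]
  exact continuous_finsetSum _ fun i _ => (hP _).mul (hQ _)

lemma PolyCont.sub {T : Type*} [TopologicalSpace T]
    {P Q : T → MvPolynomial ((F →+* K) × Fin 2) (OK K)} (hP : PolyCont P) (hQ : PolyCont Q) :
    PolyCont fun t => P t - Q t := by
  intro m
  simp only [coeff_sub]
  exact (hP _).sub (hQ _)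

lemma PolyCont.const {T : Type*} [TopologicalSpace T]
    (P : MvPolynomial ((F →+* K) × Fin 2) (OK K)) : PolyCont fun _ : T => P :=
  fun _ => continuous_const

lemma PolyCont.C {T : Type*} [TopologicalSpace T] {f : T → OK K} (hf : Continuous f) :
    PolyCont (F := F) fun t => MvPolynomial.C (f t) := by
  classical
  intro m
  simp only [coeff_C]
  split_ifs
  · exact hf
  · exact continuous_const

lemma PolyCont.pow {T : Type*} [TopologicalSpace T]
    {P : T → MvPolynomial ((F →+* K) × Fin 2) (OK K)} (hP : PolyCont P) (k : ℕ) :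
    PolyCont fun t => P t ^ k := by
  induction k with
  | zero => simpa using PolyCont.const 1
  | succ k ih => simpa only [pow_succ] using ih.mul hP

lemma PolyCont.prod {T ι : Type*} [TopologicalSpace T]
    {P : ι → T → MvPolynomial ((F →+* K) × Fin 2) (OK K)} (s : Finset ι)
    (hP : ∀ i, PolyCont (P i)) :
    PolyCont fun t => ∏ i ∈ s, P i t := by
  classical
  induction s using Finset.induction_on with
  | empty => simpa using PolyCont.const 1
  | insert a s ha ih => simpa only [Finset.prod_insert ha] using (hP a).mul ih

lemma kerPoly_cont : PolyCont fun η : {η : Rp F p × Rp F p × Rp F p // InX η} => κ.kerPoly η.1 := by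
  simp only [kerPoly, smul_eq_C_mul]
  have h1 : Continuous fun η : {η : Rp F p × Rp F p × Rp F p // InX η} => η.1.1 := by fun_prop
  have h2 : Continuous fun η : {η : Rp F p × Rp F p × Rp F p // InX η} => η.1.2.1 := by fun_prop
  have h3 : Continuous fun η : {η : Rp F p × Rp F p × Rp F p // InX η} =>
      (⟨η.1.2.2, η.2.2⟩ : {z : Rp F p // IsUnit z}) := by fun_prop
  refine PolyCont.mul (PolyCont.C ((κ.continuous_powV.comp h3).mul (κ.continuous_eps.comp h1)))
    (PolyCont.prod _ fun σ => PolyCont.pow (PolyCont.sub ?_ ?_) _)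
  · exact (PolyCont.C ((continuous_embO p σ).comp h1)).mul (PolyCont.const _)
  · exact (PolyCont.C ((continuous_embO p σ).comp h2)).mul (PolyCont.const _)

lemma kerPoly_scale {e : (Rp F p)ˣ} (he : e ∈ S.ebar) {η : Rp F p × Rp F p × Rp F p}
    (hη : InX η) : κ.kerPoly (scaleX (e : Rp F p) η) = κ.kerPoly η := by
  have hprod : ∏ σ : F →+* K, (C (embO p σ (scaleX (e : Rp F p) η).1) * X (σ, 1) -
        C (embO p σ (scaleX (e : Rp F p) η).2.1) * X (σ, 0)) ^ κ.n σ =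
      (∏ σ : F →+* K, embO p σ (e : Rp F p) ^ κ.n σ) •
      ∏ σ : F →+* K,
        (C (embO p σ η.1) * X (σ, 1) - C (embO p σ η.2.1) * X (σ, 0) :
          MvPolynomial ((F →+* K) × Fin 2) (OK K)) ^ κ.n σ := by
    rw [smul_eq_C_mul, map_prod, ← Finset.prod_mul_distrib]
    refine Finset.prod_congr rfl fun σ _ => ?_
    rw [map_pow, ← mul_pow]
    congr 1
    simp only [scaleX, map_mul]
    ring
  rw [kerPoly, kerPoly, hprod, smul_smul]
  congr 1
  have hu : ∀ σ : F →+* K, ((embO p σ (e : Rp F p) : OK K) : K) ≠ 0 := fun σ =>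
    norm_ne_zero_iff.1 (by rw [norm_embO_unit p σ e.isUnit]; exact one_ne_zero)
  have hz : ‖κ.powV η.2.2‖ ≤ 1 := (κ.norm_powV hη.2).le
  have hz' : ‖κ.powV (scaleX (e : Rp F p) η).2.2‖ ≤ 1 :=
    (κ.norm_powV ((inX_scale e η).2 hη).2).le
  apply Subtype.ext
  have ht := κ.trivial_on_ebar e he
  simp only [Subring.coe_mul, coe_toO hz, coe_toO hz']
  have e1 : (scaleX (e : Rp F p) η).1 = e * η.1 := rfl
  have e2 : (scaleX (e : Rp F p) η).2.2 = (e * e) * η.2.2 := by rw [← pow_two]; rfl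
  have e3 : (((∏ σ : F →+* K, embO p σ (e : Rp F p) ^ κ.n σ) : OK K) : K) * κ.powV (e * e) =
      ∏ σ : F →+* K, ((embO p σ (e : Rp F p) : OK K) : K) ^ κ.m := by
    rw [powV_mul, powV, ← Finset.prod_mul_distrib]
    push_cast
    rw [← Finset.prod_mul_distrib]
    refine Finset.prod_congr rfl fun σ _ => ?_
    rw [← zpow_natCast, ← zpow_add₀ (hu σ), ← zpow_add₀ (hu σ), ← κ.parallel σ, two_mul]
  rw [e1, e2, powV_mul, eps_mul, Subring.coe_mul]
  have ht' : ((κ.eps (e : Rp F p) : OK K) : K) *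
    ((((∏ σ : F →+* K, embO p σ (e : Rp F p) ^ κ.n σ) : OK K) : K) * κ.powV (e * e)) = 1 := by
    rw [e3]; exact ht
  linear_combination (κ.powV η.2.2 * ((κ.eps η.1 : OK K) : K)) * ht'

/-- The coefficient of the monomial `m` of `z^v ε(x) (xY - yX)^n`, as a continuous function
on `X`. -/
def coeffX (m : (F →+* K) × Fin 2 →₀ ℕ) : C(S.X, OK K) :=
  ⟨Quotient.lift (fun η => coeff m (κ.kerPoly η.1)) (by
      rintro η η' ⟨e, he, h⟩
      rw [h, κ.kerPoly_scale he η.2]),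
    Continuous.quotient_lift (κ.kerPoly_cont m) _⟩

lemma coeffX_eq_zero {m : (F →+* K) × Fin 2 →₀ ℕ} (hm : Finsupp.weight wt m ≠ κ.n) :
    κ.coeffX m = 0 := by
  apply ContinuousMap.ext
  rintro ⟨η⟩
  exact IsWeightedHomogeneous.coeff_eq_zero (κ.kerPoly_mem η.1) m hm

lemma finite_monos : {m : (F →+* K) × Fin 2 →₀ ℕ | Finsupp.weight wt m = κ.n}.Finite := by
  classical
  refine (Set.finite_Icc (0 : (F →+* K) × Fin 2 →₀ ℕ)
    (Finsupp.equivFunOnFinite.symm fun i => κ.n i.1)).subset fun m hm => ⟨zero_le, fun i => ?_⟩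
  change m i ≤ κ.n i.1
  rw [← hm]
  exact weight_wt m i

/-- The monomials of degree `n_σ` in `X_σ, Y_σ`. -/
def monos : Finset ((F →+* K) × Fin 2 →₀ ℕ) := κ.finite_monos.toFinset

lemma mem_monos {m : (F →+* K) × Fin 2 →₀ ℕ} : m ∈ κ.monos ↔ Finsupp.weight wt m = κ.n := by
  simp [monos]

/-- The specialization map `ρ_κ(μ) = ∫_{X'} z^v ε(x) (xY - yX)^n dμ(x, y, z)`, the integral being
taken coefficient by coefficient. -/
def rho : Meas S K →ₗ[OK K] κ.L where
  toFun μ := ⟨∑ m ∈ κ.monos, monomial m (μ (κ.coeffX m)), by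
    exact Submodule.sum_mem _ fun m hm =>
      isWeightedHomogeneous_monomial _ _ _ (κ.mem_monos.1 hm)⟩
  map_add' μ ν := by
    apply Subtype.ext
    simp [Finset.sum_add_distrib]
  map_smul' r μ := by
    apply Subtype.ext
    simp [Finset.smul_sum, smul_monomial]

lemma kerPoly_star {u : GLf F} (hu : u ∈ U0 (Ideal.span {(p : 𝓞 F) ^ κ.α}))
    (η : Rp F p × Rp F p × Rp F p) :
    κ.kerPoly (starX p u η) = (κ.eps (pMat p u 0 0) * toO (1 * κ.powV (pMat p u).det)) •
      subst K (pMat p u) (κ.kerPoly η) := by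
  have hu' := U0_mono le_top hu
  have hn : ‖κ.powV (pMat p u).det‖ = 1 := κ.norm_powV (isUnit_det_pMat p hu')
  rw [kerPoly, kerPoly, map_smul, smul_smul, map_prod]
  congr 1
  · simp only [starX, unitPart_unit hu', powV_mul, one_mul]
    rw [toO_mul_of_norm_eq_one _ _ hn,
      κ.eps_add (Ideal.mul_mem_left _ _ (pMat_mem_span (U0_le_Delta0 _ u hu))), eps_mul]
    ring
  · refine Finset.prod_congr rfl fun σ _ => ?_
    rw [map_pow]
    congr 1
    simp [starX, subst]
    ring

lemma rho_coe (μ : Meas S K) : ((κ.rho μ : κ.L) : MvPolynomial ((F →+* K) × Fin 2) (OK K)) =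
    ∑ m ∈ κ.monos, monomial m (μ (κ.coeffX m)) := rfl

lemma coeff_rho (μ : Meas S K) (m : (F →+* K) × Fin 2 →₀ ℕ) :
    coeff m ((κ.rho μ : κ.L) : MvPolynomial ((F →+* K) × Fin 2) (OK K)) = μ (κ.coeffX m) := by
  classical
  rw [rho_coe, coeff_sum]
  simp only [coeff_monomial, Finset.sum_ite_eq', mem_monos]
  split_ifs with h
  · rfl
  · rw [κ.coeffX_eq_zero h, map_zero]

lemma kerPoly_sum (η : Rp F p × Rp F p × Rp F p) : κ.kerPoly η =
    ∑ m ∈ κ.monos, monomial m (coeff m (κ.kerPoly η)) := by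
  classical
  refine MvPolynomial.ext _ _ fun m => ?_
  rw [coeff_sum]
  simp only [coeff_monomial, Finset.sum_ite_eq', mem_monos]
  split_ifs with h
  · rfl
  · exact IsWeightedHomogeneous.coeff_eq_zero (κ.kerPoly_mem η) m h

lemma sum_smul_apply {K T ι : Type*} [NormedField K] [IsUltrametricDist K] [TopologicalSpace T]
    (s : Finset ι) (r : ι → OK K) (f : ι → C(T, OK K)) (q : T) :
    (∑ i ∈ s, r i • f i) q = ∑ i ∈ s, r i * f i q := by
  simp

/-- The specialization map is equivariant. -/
lemma rho_equivariant {u : GLf F} (hu : u ∈ U0 (Ideal.span {(p : 𝓞 F) ^ κ.α})) (μ : Meas S K) :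
    κ.rho (measAct S u μ) = κ.slash 1 u (κ.rho μ) := by
  apply Subtype.ext
  refine MvPolynomial.ext _ _ fun m => ?_
  rw [coeff_rho, slash_apply, coeff_smul, rho_coe, measAct_apply, map_sum, coeff_sum]
  have key : pull S u (κ.coeffX m) = ∑ m' ∈ κ.monos,
      ((κ.eps (pMat p u 0 0) * toO (1 * κ.powV (pMat p u).det)) *
        coeff m (subst K (pMat p u) (monomial m' 1))) • κ.coeffX m' := by
    apply ContinuousMap.ext
    rintro ⟨η⟩
    have hη : InX (starX p u η.1) := (inX_starX_unit (U0_mono le_top hu) _).2 η.2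
    have h1 : pull S u (κ.coeffX m) (Quot.mk _ η) = coeff m (κ.kerPoly (starX p u η.1)) := by
      change extendX S (κ.coeffX m) (starX p u η.1) = _
      simp only [extendX, hη, dif_pos]
      rfl
    have h2 : ∀ m', κ.coeffX m' (Quot.mk _ η) = coeff m' (κ.kerPoly η.1) := fun m' => rfl
    rw [h1, κ.kerPoly_star hu η.1, coeff_smul, κ.kerPoly_sum η.1, map_sum, coeff_sum,
      Finset.smul_sum]
    refine Eq.trans ?_ (sum_smul_apply _ _ _ _).symm
    refine Finset.sum_congr rfl fun m' _ => ?_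
    rw [h2, ← mul_one (coeff m' (κ.kerPoly η.1)),
      ← smul_eq_mul (coeff m' (κ.kerPoly η.1)), ← smul_monomial, map_smul, coeff_smul]
    simp only [smul_eq_mul]
    ring
  rw [key, map_sum, Finset.smul_sum]
  refine Finset.sum_congr rfl fun m' _ => ?_
  rw [map_smul, ← mul_one (μ (κ.coeffX m')), ← smul_eq_mul (μ (κ.coeffX m')), ← smul_monomial,
    map_smul, coeff_smul]
  simp only [smul_eq_mul]
  ring

end ArithWeight

end Specialization

section ModularSymbols

variable {F : Type*} [Field F] [NumberField F] {p : ℕ} [Fact p.Prime]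
variable (S : TameLevel F p)
variable (K : Type*) [NormedField K] [IsUltrametricDist K] [CharZero K] [NormedAlgebra ℚ_[p] K]
  [FiniteDimensional ℚ_[p] K]

/-- The matrix `(1, 0; 0, q)`, for an idele `q`. -/
def diagOne (q : (FiniteAdeleRing (𝓞 F) F)ˣ) : GLf F where
  val := !![1, 0; 0, (q : FiniteAdeleRing (𝓞 F) F)]
  inv := !![1, 0; 0, ((q⁻¹ : (FiniteAdeleRing (𝓞 F) F)ˣ) : FiniteAdeleRing (𝓞 F) F)]
  val_inv := by simp [Matrix.one_fin_two]
  inv_val := by simp [Matrix.one_fin_two]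

/-- The idele `q` is integral at all the finite places. -/
def IsIntegralIdele (q : (FiniteAdeleRing (𝓞 F) F)ˣ) : Prop :=
  ∀ w : HeightOneSpectrum (𝓞 F), (q : FiniteAdeleRing (𝓞 F) F) w ∈ w.adicCompletionIntegers F

lemma diagOne_mem {q : (FiniteAdeleRing (𝓞 F) F)ˣ} (hq : IsIntegralIdele q) (𝔪 : Ideal (𝓞 F)) :
    diagOne q ∈ Delta0 𝔪 := by
  intro w
  refine ⟨!![1, 0; 0, ⟨_, hq w⟩], ?_, by simp⟩
  ext i j
  fin_cases i <;> fin_cases j <;> rfl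

/-- `q` is an idele that generates `𝔮` at the prime `𝔮`, with component `1` at the other primes. -/
def IsPrimeIdele (𝔮 : HeightOneSpectrum (𝓞 F)) (q : (FiniteAdeleRing (𝓞 F) F)ˣ) : Prop :=
  Valued.v ((q : FiniteAdeleRing (𝓞 F) F) 𝔮) = WithZero.exp (-1 : ℤ) ∧
    ∀ w, w ≠ 𝔮 → (q : FiniteAdeleRing (𝓞 F) F) w = 1

lemma IsPrimeIdele.isIntegral {F : Type*} [Field F] [NumberField F] {𝔮 : HeightOneSpectrum (𝓞 F)}
    {q : (FiniteAdeleRing (𝓞 F) F)ˣ} (h : IsPrimeIdele 𝔮 q) : IsIntegralIdele q := by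
  intro w
  by_cases hw : w = 𝔮
  · subst hw
    rw [mem_adicCompletionIntegers, h.1, ← WithZero.exp_zero, WithZero.exp_le_exp]
    norm_num
  · rw [h.2 w hw]
    exact one_mem _

variable (p) in
/-- `ϖ` is the idele with component `p` at the primes above `p` and `1` at the other primes. -/
def IsPIdele (ϖ : (FiniteAdeleRing (𝓞 F) F)ˣ) : Prop :=
  (∀ w : HeightOneSpectrum (𝓞 F), (p : 𝓞 F) ∈ w.asIdeal →
    (ϖ : FiniteAdeleRing (𝓞 F) F) w = (p : w.adicCompletion F)) ∧
  ∀ w : HeightOneSpectrum (𝓞 F), (p : 𝓞 F) ∉ w.asIdeal → (ϖ : FiniteAdeleRing (𝓞 F) F) w = 1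

lemma IsPIdele.isIntegral {F : Type*} [Field F] [NumberField F] {p : ℕ}
    {ϖ : (FiniteAdeleRing (𝓞 F) F)ˣ} (h : IsPIdele p ϖ) : IsIntegralIdele ϖ := by
  intro w
  by_cases hw : (p : 𝓞 F) ∈ w.asIdeal
  · rw [h.1 w hw]
    exact natCast_mem _ p
  · rw [h.2 w hw]
    exact one_mem _

/-- The module `𝕎 = H^d_cpt(X_S, 𝒟_X)` of `Λ`-adic modular symbols, where `d = [F : ℚ]`. -/
abbrev LambdaSymbols : Type _ :=
  Hcpt (R := OK K) (E := Meas S K) S.S (measAct S) (Module.finrank ℚ F)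

/-- The Hecke operator `Φ ↦ Φ * T(x)` on `𝕎`, for an integral matrix `x`. -/
def LambdaSymbols.T (x : GLf F) (hx : x ∈ Delta0 (⊤ : Ideal (𝓞 F))) :
    LambdaSymbols S K →ₗ[OK K] LambdaSymbols S K :=
  hecke S.isOpen S.isCompact x (measAct S) (measAct_compat S hx) (Module.finrank ℚ F)

variable {S K}

/-- A level of the weight `κ`: an open subgroup `U` with `S(p^α) ⊆ U ⊆ S₀(p^α)`. -/
structure ArithWeight.Level (κ : ArithWeight S K) where
  U : Subgroup (GLf F)
  isOpen : IsOpen (U : Set (GLf F))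
  ge : S.S ⊓ Ufull (Ideal.span {(p : 𝓞 F) ^ κ.α}) ≤ U
  le : U ≤ S.S ⊓ U0 (Ideal.span {(p : 𝓞 F) ^ κ.α})

namespace ArithWeight.Level

variable {κ : ArithWeight S K} (V : κ.Level)

lemma le_S : V.U ≤ S.S := V.le.trans inf_le_left

lemma le_U0 : V.U ≤ U0 (Ideal.span {(p : 𝓞 F) ^ κ.α}) := V.le.trans inf_le_right

lemma isCompact : IsCompact (V.U : Set (GLf F)) :=
  S.isCompact.of_isClosed_subset (V.U.isClosed_of_isOpen V.isOpen) V.le_S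

/-- The module `𝕎_κ = H^d_cpt(X_U, ℒ(n, v, ε, 𝒪))` of classical modular symbols. -/
abbrev Symbols : Type _ :=
  Hcpt (R := OK K) (E := κ.L) V.U (κ.slash 1) (Module.finrank ℚ F)

/-- The Hecke operator `t · T(x)` on `𝕎_κ`, for `x ∈ Δ₀(p^α)` and a scalar `t ∈ K`. The scalar is
multiplied with the operation of the double coset of `x` on `L(n, v, ε, K)`, so that the operator is
defined as soon as `t · P|_ε s` has coefficients in `𝒪` for `P ∈ L(n, v, ε, 𝒪)` and `s ∈ U x U`. -/
def scaledT (t : K) (x : GLf F) (hx : x ∈ Delta0 (Ideal.span {(p : 𝓞 F) ^ κ.α})) :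
    V.Symbols →ₗ[OK K] V.Symbols :=
  hecke V.isOpen V.isCompact x (κ.slash t) (κ.slash_compat V.le_U0 t hx) (Module.finrank ℚ F)

/-- The Hecke operator `T(x)` on `𝕎_κ`. -/
def T (x : GLf F) (hx : x ∈ Delta0 (Ideal.span {(p : 𝓞 F) ^ κ.α})) :
    V.Symbols →ₗ[OK K] V.Symbols :=
  V.scaledT 1 x hx

/-- The normalized Hecke operator `T₀(p) = ({p}^v)⁻¹ T(p)` on `𝕎_κ`, where
`T(p) = T((1, 0; 0, ϖ))` and `{p}^v = ∏_σ p^{v_σ}`. -/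
def T0 (ϖ : (FiniteAdeleRing (𝓞 F) F)ˣ) (hϖ : IsPIdele p ϖ) : V.Symbols →ₗ[OK K] V.Symbols :=
  V.scaledT (∏ σ : F →+* K, (p : K) ^ κ.v σ)⁻¹ (diagOne ϖ) (diagOne_mem hϖ.isIntegral _)

/-- The specialization map on cochains, with the restriction from `X_S` to `X_U`. -/
def rhoCochain (k : ℕ) :
    Cochain (R := OK K) (E := Meas S K) S.S (measAct S) k →ₗ[OK K]
      Cochain (R := OK K) (E := κ.L) V.U (κ.slash 1) k :=
  pushCochain (R := OK K) (E := Meas S K) (E' := κ.L) V.le_S S.isCompact κ.rho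
    (fun _ hu μ => κ.rho_equivariant (V.le_U0 hu) μ) k

lemma rhoCochain_coboundary (k : ℕ)
    (c : Cochain (R := OK K) (E := Meas S K) S.S (measAct S) k) :
    V.rhoCochain (k + 1) (coboundary (R := OK K) (E := Meas S K) S.S (measAct S) k c) =
      coboundary (R := OK K) (E := κ.L) V.U (κ.slash 1) k (V.rhoCochain k c) := by
  apply Subtype.ext; funext g τ
  change κ.rho (∑ i : Fin (k + 2), (-1 : OK K) ^ (i : ℕ) • c.1 g (face i τ)) =
    ∑ i : Fin (k + 2), (-1 : OK K) ^ (i : ℕ) • κ.rho (c.1 g (face i τ))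
  simp only [map_sum, map_smul]

/-- The specialization map `ρ_κ : 𝕎 → 𝕎_κ`. -/
def rho : LambdaSymbols S K →ₗ[OK K] V.Symbols :=
  Hcpt.map (R := OK K) (E := Meas S K) (E' := κ.L) V.rhoCochain V.rhoCochain_coboundary
    (Module.finrank ℚ F)

end ArithWeight.Level

end ModularSymbols

end HilbertSymbols

end

open HilbertSymbols

/-!
Let `x = diag(1, q)` with `q` a prime idele prime to `p`, or `q = ϖ`, and let `z ∈ 𝔯_p` be the
component of `q` at `p`, so `z = 1` or `z = p`. Conjugation by `x` carries an element of `U` that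
stays in `S` to an element of `U`, because modulo `p ^ α` it does not change the diagonal; hence
`U \ U x U` injects into `S \ S x S`. It remains to compare the summands of the two Hecke operators.

* A coset `S x k` with `k ∈ S` comes from `U` as soon as the upper left entry `k₀₀` is coprime to
  `z` in `𝔯_p`: then `diag(1, z) k_p = l diag(1, z) n` with `l ∈ GL₂(𝔯_p)` and `n` upper unipotent,
  and both `l` and `n` extend to elements of `S` since `𝔫` is prime to `p`.
* Otherwise `k₀₀` and `z` lie in a proper ideal of `𝔯_p`, which then contains the first column of
  `s_p` for every `s ∈ S x k`. So `η * s` has a nonunit first coordinate for every `η`, and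
  `ρ_κ (μ * s) = 0`.

On the common cosets `ρ_κ` intertwines `μ ↦ μ * s` with the action of `s` on polynomials, up to
replacing `det(s_p) ^ v` by `δ(s) ^ v`. As `p` is unramified, `det s_p = p δ(s)` for `q = ϖ`, and
the discrepancy is the factor `{p} ^ v` that is divided out in `T₀(p)`.
-/

namespace HilbertSymbols

section RightCosets

variable {G : Type*} [Group G] {U U' : Subgroup G}

/-- The projection `U' \ G → U \ G` of right coset spaces, for subgroups `U' ≤ U` of `G`. -/
def cosetMap (hU : U' ≤ U) :
    Quotient (QuotientGroup.rightRel U') → Quotient (QuotientGroup.rightRel U) :=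
  Quotient.map id fun _ _ h =>
    QuotientGroup.rightRel_apply.2 (hU (QuotientGroup.rightRel_apply.1 h))

lemma mk_out_cosetMap (hU : U' ≤ U) (q : Quotient (QuotientGroup.rightRel U')) :
    Quotient.mk (QuotientGroup.rightRel U) (cosetMap hU q).out = Quotient.mk _ q.out := by
  conv_lhs => rw [Quotient.out_eq, ← Quotient.out_eq q]
  rfl

lemma cosetMap_injOn_doubleCosets (hU : U' ≤ U) {x : G}
    (hx : ∀ u ∈ U', x * u * x⁻¹ ∈ U → x * u * x⁻¹ ∈ U') :
    Set.InjOn (cosetMap hU) (doubleCosets U' x) := by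
  rintro _ ⟨u, hu, rfl⟩ _ ⟨v, hv, rfl⟩ h
  have hU' : x * v * (x * u)⁻¹ ∈ U := QuotientGroup.rightRel_apply.1 (Quotient.exact h)
  have hconj : x * v * (x * u)⁻¹ = x * (v * u⁻¹) * x⁻¹ := by group
  refine Quotient.sound (QuotientGroup.rightRel_apply.2 ?_)
  rw [hconj] at hU' ⊢
  exact hx _ (U'.mul_mem hv (U'.inv_mem hu)) hU'

lemma image_cosetMap_doubleCosets_subset (hU : U' ≤ U) (x : G) :
    cosetMap hU '' doubleCosets U' x ⊆ doubleCosets U x := by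
  rintro _ ⟨_, ⟨u, hu, rfl⟩, rfl⟩
  exact ⟨u, hU hu, rfl⟩

lemma mk_mem_image_cosetMap (hU : U' ≤ U) {x s u : G} (hu : u ∈ U') (hs : s * (x * u)⁻¹ ∈ U) :
    Quotient.mk (QuotientGroup.rightRel U) s ∈ cosetMap hU '' doubleCosets U' x :=
  ⟨_, ⟨u, hu, rfl⟩, Quotient.sound (QuotientGroup.rightRel_apply.2 hs)⟩

end RightCosets

section HeckeFunctoriality

variable {F : Type*} [Field F] [NumberField F] {R : Type*} [CommRing R]
  {E : Type*} [AddCommGroup E] [Module R E] {E' : Type*} [AddCommGroup E'] [Module R E']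
  {U U' : Subgroup (GLf F)} {act : GLf F → E →ₗ[R] E} {act' : GLf F → E' →ₗ[R] E'}

lemma pushCochain_coboundary (hU : U' ≤ U) (hUc : IsCompact (U : Set (GLf F))) (f : E →ₗ[R] E')
    (hf : ∀ u ∈ U', ∀ e, f (act u e) = act' u (f e)) (k : ℕ) (c : Cochain U act k) :
    pushCochain hU hUc f hf (k + 1) (coboundary U act k c) =
      coboundary U' act' k (pushCochain hU hUc f hf k c) := by
  apply Subtype.ext
  funext g τ
  change f (∑ i : Fin (k + 2), (-1 : R) ^ (i : ℕ) • c.1 g (face i τ)) =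
    ∑ i : Fin (k + 2), (-1 : R) ^ (i : ℕ) • f (c.1 g (face i τ))
  simp only [map_sum, map_smul]

lemma Hcpt.map_comm (f : ∀ k, Cochain U act k →ₗ[R] Cochain U' act' k)
    (hf : ∀ k c, f (k + 1) (coboundary U act k c) = coboundary U' act' k (f k c))
    (T : ∀ k, Cochain U act k →ₗ[R] Cochain U act k)
    (hT : ∀ k c, T (k + 1) (coboundary U act k c) = coboundary U act k (T k c))
    (T' : ∀ k, Cochain U' act' k →ₗ[R] Cochain U' act' k)
    (hT' : ∀ k c, T' (k + 1) (coboundary U' act' k c) = coboundary U' act' k (T' k c))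
    (k : ℕ) (h : ∀ c, f k (T k c) = T' k (f k c)) (Φ : Hcpt U act k) :
    Hcpt.map f hf k (Hcpt.map T hT k Φ) = Hcpt.map T' hT' k (Hcpt.map f hf k Φ) := by
  obtain ⟨c, rfl⟩ := Submodule.Quotient.mk_surjective _ Φ
  exact congrArg Submodule.Quotient.mk (Subtype.ext (h c.1))

variable {x : GLf F} {op : GLf F → E →ₗ[R] E} {op' : GLf F → E' →ₗ[R] E'}

lemma map_heckeFun_eq_heckeFun (hU : U' ≤ U) (hUo : IsOpen (U : Set (GLf F)))
    (hUc : IsCompact (U : Set (GLf F))) (hop : HeckeCompat U act x op) (f : E →ₗ[R] E')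
    (hinj : Set.InjOn (cosetMap hU) (doubleCosets U' x))
    (hcomm : ∀ a ∈ U', ∀ b ∈ U', ∀ e, f (op (a * x * b) e) = op' (a * x * b) (f e))
    (hzero : ∀ a ∈ U, ∀ b ∈ U,
      Quotient.mk _ (a * x * b) ∉ cosetMap hU '' doubleCosets U' x → ∀ e, f (op (a * x * b) e) = 0)
    {k : ℕ} (c : Cochain U act k) (g : GLf F) (τ : Simplex F k) :
    f (heckeFun U x op c.1 g τ) = heckeFun U' x op' (k := k) (fun g τ => f (c.1 g τ)) g τ := by
  let term (q : Quotient (QuotientGroup.rightRel U)) : E' := f (op q.out (c.1 (g * q.out⁻¹) τ))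
  have hterm_zero : ∀ q ∈ doubleCosets U x, q ∉ cosetMap hU '' doubleCosets U' x → term q = 0 := by
    intro q hq hq'
    obtain ⟨a, ha, b, hb, hab⟩ := out_mem hq
    rw [← Quotient.out_eq q, hab] at hq'
    simpa only [term, hab] using hzero a ha b hb hq' _
  have hterm_image : ∀ q ∈ doubleCosets U' x,
      term (cosetMap hU q) = op' q.out (f (c.1 (g * q.out⁻¹) τ)) := by
    intro q hq
    obtain ⟨a, ha, b, hb, hab⟩ := out_mem hq
    simp only [term]
    rw [heckeTerm_eq hop c g τ ⟨a, hU ha, b, hU hb, hab⟩ (mk_out_cosetMap hU q).symm, hab,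
      hcomm a ha b hb]
  calc f (heckeFun U x op c.1 g τ)
      = ∑ᶠ q ∈ doubleCosets U x, term q :=
        f.toAddMonoidHom.map_finsum_mem _ (finite_doubleCosets hUo hUc x)
    _ = ∑ᶠ q ∈ cosetMap hU '' doubleCosets U' x, term q :=
        finsum_mem_inter_support_eq' _ _ _ fun q hq =>
          ⟨fun hq' => by_contra fun h => hq (hterm_zero q hq' h),
            fun hq' => image_cosetMap_doubleCosets_subset hU x hq'⟩
    _ = ∑ᶠ q ∈ doubleCosets U' x, term (cosetMap hU q) := finsum_mem_image hinj
    _ = heckeFun U' x op' (k := k) (fun g τ => f (c.1 g τ)) g τ :=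
        finsum_mem_congr rfl hterm_image

lemma Hcpt.map_pushCochain_hecke (hU : U' ≤ U) (hUo : IsOpen (U : Set (GLf F)))
    (hUc : IsCompact (U : Set (GLf F))) (hUo' : IsOpen (U' : Set (GLf F)))
    (hUc' : IsCompact (U' : Set (GLf F))) (hop : HeckeCompat U act x op)
    (hop' : HeckeCompat U' act' x op') (f : E →ₗ[R] E')
    (hf : ∀ u ∈ U', ∀ e, f (act u e) = act' u (f e))
    (hinj : Set.InjOn (cosetMap hU) (doubleCosets U' x))
    (hcomm : ∀ a ∈ U', ∀ b ∈ U', ∀ e, f (op (a * x * b) e) = op' (a * x * b) (f e))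
    (hzero : ∀ a ∈ U, ∀ b ∈ U,
      Quotient.mk _ (a * x * b) ∉ cosetMap hU '' doubleCosets U' x → ∀ e, f (op (a * x * b) e) = 0)
    (k : ℕ) (Φ : Hcpt U act k) :
    Hcpt.map (pushCochain hU hUc f hf) (pushCochain_coboundary hU hUc f hf) k
        (hecke hUo hUc x op hop k Φ) =
      hecke hUo' hUc' x op' hop' k
        (Hcpt.map (pushCochain hU hUc f hf) (pushCochain_coboundary hU hUc f hf) k Φ) :=
  Hcpt.map_comm _ _ _ _ _ _ k (fun c => Subtype.ext <| funext fun g => funext fun τ =>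
    map_heckeFun_eq_heckeFun hU hUo hUc hop f hinj hcomm hzero c g τ) Φ

end HeckeFunctoriality

section Places

variable {F : Type*} [Field F] [NumberField F] {p : ℕ}

lemma isUnit_algebraMap_adicCompletionIntegers_iff (w : HeightOneSpectrum (𝓞 F)) (a : 𝓞 F) :
    IsUnit (algebraMap (𝓞 F) (w.adicCompletionIntegers F) a) ↔ a ∉ w.asIdeal := by
  rw [adicCompletionIntegers.isUnit_iff_valued_eq_one, ← valuation_lt_one_iff_mem (K := F), not_lt]
  change Valued.v ((algebraMap (𝓞 F) F a : F) : w.adicCompletion F) = 1 ↔ _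
  rw [valuedAdicCompletion_eq_valuation']
  exact ⟨fun h => h.ge, fun h => le_antisymm (valuation_le_one w a) h⟩

lemma idealAt_eq_top {𝔪 : Ideal (𝓞 F)} {w : HeightOneSpectrum (𝓞 F)} (h : ¬ 𝔪 ≤ w.asIdeal) :
    idealAt 𝔪 w = ⊤ := by
  obtain ⟨a, ha, haw⟩ := SetLike.not_le_iff_exists.1 h
  exact Ideal.eq_top_of_isUnit_mem _ (Ideal.mem_map_of_mem _ ha)
    ((isUnit_algebraMap_adicCompletionIntegers_iff w a).2 haw)

lemma natCast_mem_jacobson_bot : (p : Rp F p) ∈ Ideal.jacobson (⊥ : Ideal (Rp F p)) := by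
  refine Ideal.mem_jacobson_bot.2 fun y => Pi.isUnit_iff.2 fun w => ?_
  have hp : (p : w.1.adicCompletionIntegers F) ∈
      IsLocalRing.maximalIdeal (w.1.adicCompletionIntegers F) := by
    rw [IsLocalRing.mem_maximalIdeal, mem_nonunits_iff,
      ← map_natCast (algebraMap (𝓞 F) (w.1.adicCompletionIntegers F)),
      isUnit_algebraMap_adicCompletionIntegers_iff, not_not]
    exact w.2
  rw [← IsLocalRing.jacobson_eq_maximalIdeal ⊥ bot_ne_top] at hp
  exact Ideal.mem_jacobson_bot.1 hp (y w)

end Places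

section Specialization

variable {F : Type*} [Field F] [NumberField F] {p : ℕ} [Fact p.Prime] {S : TameLevel F p}
  {K : Type*} [NormedField K] [IsUltrametricDist K] [CharZero K] [NormedAlgebra ℚ_[p] K]
  [FiniteDimensional ℚ_[p] K]

lemma coeff_map_sum_monomial {R σ : Type*} [CommRing R]
    (T : MvPolynomial σ R →ₗ[R] MvPolynomial σ R) (s : Finset (σ →₀ ℕ))
    (c : (σ →₀ ℕ) → R) (m : σ →₀ ℕ) :
    coeff m (T (∑ m' ∈ s, monomial m' (c m'))) =
      ∑ m' ∈ s, coeff m (T (monomial m' 1)) * c m' := by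
  rw [map_sum, coeff_sum]
  refine Finset.sum_congr rfl fun m' _ => ?_
  rw [← mul_one (c m'), ← smul_eq_mul, ← smul_monomial, map_smul, coeff_smul, smul_eq_mul,
    smul_eq_mul, mul_one, mul_comm]

namespace ArithWeight

variable (κ : ArithWeight S K)

lemma eps_eq_zero {x : Rp F p} (hx : ¬ IsUnit x) : κ.eps x = 0 := by
  have : IsLocalHom (Ideal.Quotient.mk (Ideal.span {(p : Rp F p) ^ κ.α})) := by
    refine isLocalHom_of_le_jacobson_bot _ ((Ideal.span_singleton_le_iff_mem _).2 ?_)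
    exact Ideal.pow_mem_of_mem _ natCast_mem_jacobson_bot _ κ.one_le_α
  exact κ.ε.map_nonunit fun h => hx (isUnit_of_map_unit _ _ h)

lemma kerPoly_eq_zero {η : Rp F p × Rp F p × Rp F p} (hη : ¬ IsUnit η.1) : κ.kerPoly η = 0 := by
  rw [kerPoly, κ.eps_eq_zero hη, mul_zero, zero_smul]

lemma pull_coeffX {s : GLf F} (hs : IsUnit (unitPart p s)) (m : (F →+* K) × Fin 2 →₀ ℕ)
    (η : {η : Rp F p × Rp F p × Rp F p // InX η}) :
    pull S s (κ.coeffX m) (Quotient.mk S.setoidX η) = coeff m (κ.kerPoly (starX p s η.1)) := by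
  change extendX S (κ.coeffX m) (starX p s η.1) = _
  by_cases h : InX (starX p s η.1)
  · simp only [extendX, h, dif_pos]
    rfl
  · have hx : ¬ IsUnit (starX p s η.1).1 := fun hx =>
      h ⟨fun w => Or.inl (Pi.isUnit_iff.1 hx w), η.2.2.mul hs⟩
    simp only [extendX, h, dif_neg, not_false_eq_true, κ.kerPoly_eq_zero hx, coeff_zero]

lemma rho_measAct_of_kerPoly_starX {s : GLf F} (hs : IsUnit (unitPart p s))
    (T : MvPolynomial ((F →+* K) × Fin 2) (OK K) →ₗ[OK K]
      MvPolynomial ((F →+* K) × Fin 2) (OK K))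
    (hT : ∀ η, κ.kerPoly (starX p s η) = T (κ.kerPoly η)) (μ : Meas S K) :
    (κ.rho (measAct S s μ) : MvPolynomial ((F →+* K) × Fin 2) (OK K)) = T (κ.rho μ) := by
  refine MvPolynomial.ext _ _ fun m => ?_
  have hpull : pull S s (κ.coeffX m) =
      ∑ m' ∈ κ.monos, coeff m (T (monomial m' 1)) • κ.coeffX m' := by
    apply ContinuousMap.ext
    rintro ⟨η⟩
    refine (κ.pull_coeffX hs m η).trans ?_
    rw [hT, κ.kerPoly_sum, coeff_map_sum_monomial]
    exact (sum_smul_apply κ.monos (fun m' => coeff m (T (monomial m' 1))) κ.coeffX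
      (Quot.mk _ η)).symm
  rw [coeff_rho, measAct_apply, hpull, rho_coe, coeff_map_sum_monomial, map_sum]
  simp only [map_smul, smul_eq_mul]

lemma kerPoly_starX {s : GLf F} (hs : s ∈ Delta0 (Ideal.span {(p : 𝓞 F) ^ κ.α})) {t : K}
    (hu : IsUnit (unitPart p s)) (ht : κ.powV (unitPart p s) = t * κ.powV (pMat p s).det)
    (η : Rp F p × Rp F p × Rp F p) :
    κ.kerPoly (starX p s η) = (κ.eps (pMat p s 0 0) * toO (t * κ.powV (pMat p s).det)) •
      subst K (pMat p s) (κ.kerPoly η) := by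
  rw [kerPoly, kerPoly, map_smul, smul_smul, map_prod]
  congr 1
  · simp only [starX, powV_mul]
    rw [toO_mul_of_norm_eq_one _ _ (κ.norm_powV hu),
      κ.eps_add (Ideal.mul_mem_left _ _ (pMat_mem_span hs)), eps_mul, ht]
    ring
  · refine Finset.prod_congr rfl fun σ _ => ?_
    rw [map_pow]
    congr 1
    simp only [starX, subst, map_add, map_mul, map_sub, aeval_X, algHom_C, algebraMap_eq,
      Matrix.cons_val_zero, Matrix.cons_val_one, Matrix.cons_val_fin_one]
    ring

lemma rho_measAct {s : GLf F} (hs : s ∈ Delta0 (Ideal.span {(p : 𝓞 F) ^ κ.α})) {t : K}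
    (hu : IsUnit (unitPart p s)) (ht : κ.powV (unitPart p s) = t * κ.powV (pMat p s).det)
    (μ : Meas S K) : κ.rho (measAct S s μ) = κ.slash t s (κ.rho μ) :=
  Subtype.ext <| κ.rho_measAct_of_kerPoly_starX hu
    ((κ.eps (pMat p s 0 0) * toO (t * κ.powV (pMat p s).det)) • (subst K (pMat p s)).toLinearMap)
    (κ.kerPoly_starX hs hu ht) μ

lemma rho_measAct_eq_zero {s : GLf F} (hu : IsUnit (unitPart p s)) {I : Ideal (Rp F p)}
    (hI : I ≠ ⊤) (hcol : ∀ i, pMat p s i 0 ∈ I) (μ : Meas S K) : κ.rho (measAct S s μ) = 0 := by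
  have hker : ∀ η, κ.kerPoly (starX p s η) = 0 := fun η => κ.kerPoly_eq_zero fun h =>
    hI (I.eq_top_of_isUnit_mem
      (I.add_mem (I.mul_mem_left _ (hcol 0)) (I.mul_mem_left _ (hcol 1))) h)
  exact Subtype.ext (κ.rho_measAct_of_kerPoly_starX hu 0 hker μ)

end ArithWeight

end Specialization

section Matrices

open Matrix.GeneralLinearGroup (upperRightHom)

variable {R : Type*} [CommRing R]

lemma upperRightHom_mem_localGamma (J : Ideal R) (b : R) : upperRightHom b ∈ localGamma J := by
  refine ⟨⟨?_, ?_⟩, ?_⟩ <;> simp [upperRightHom]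

lemma exists_mul_diag_upperRightHom (k : GL (Fin 2) R) {z : R} (hk : IsCoprime (k 0 0) z) :
    ∃ (l : GL (Fin 2) R) (b : R),
      l.1 * (!![1, 0; 0, z] * (upperRightHom b).1) = !![1, 0; 0, z] * k.1 := by
  obtain ⟨a, c, hac⟩ := hk
  have hdet : IsUnit !![k 0 0, c * k 0 1; z * k 1 0, k 1 1 - k 1 0 * (a * k 0 1)].det := by
    rw [Matrix.det_fin_two_of]
    convert k.det.isUnit using 1
    rw [Matrix.GeneralLinearGroup.val_det_apply, Matrix.det_fin_two]
    linear_combination (-k 1 0 * k 0 1) * hac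
  refine ⟨Matrix.GeneralLinearGroup.mk'' _ hdet, a * k 0 1, ?_⟩
  change !![k 0 0, c * k 0 1; z * k 1 0, k 1 1 - k 1 0 * (a * k 0 1)] *
    (!![1, 0; 0, z] * !![1, a * k 0 1; 0, 1]) = _
  have h01 : k 0 0 * (a * k 0 1) + c * k 0 1 * z = k 0 1 := by linear_combination k 0 1 * hac
  have h11 : z * k 1 0 * (a * k 0 1) + (k 1 1 - k 1 0 * (a * k 0 1)) * z = z * k 1 1 := by ring
  rw [Matrix.eta_fin_two k.1]
  simp [h01, h11]

lemma mul_inv_mem_localGamma_of_mul_diag_eq {J : Ideal R} {k l : GL (Fin 2) R} {z : R}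
    (hz : z ∈ nonZeroDivisors R) (hk : k ∈ localGamma0 J)
    (h : l.1 * !![1, 0; 0, z] = !![1, 0; 0, z] * k.1) : l * k⁻¹ ∈ localGamma J := by
  have hk' : k 1 0 ∈ J := hk
  have h00 : l 0 0 = k 0 0 := by simpa [Matrix.mul_apply] using congr($h 0 0)
  have h10 : l 1 0 = z * k 1 0 := by simpa [Matrix.mul_apply] using congr($h 1 0)
  have h11 : l 1 1 = k 1 1 := by
    have h11 : l 1 1 * z = z * k 1 1 := by simpa [Matrix.mul_apply] using congr($h 1 1)
    exact (mul_cancel_right_mem_nonZeroDivisors hz).1 (h11.trans (mul_comm _ _))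
  have hdet := GL_det_inv_mul k
  set D : R := ((k.det⁻¹ : Rˣ) : R)
  have hmul : (l * k⁻¹).1 = l.1 * (D • !![k 1 1, -k 0 1; -k 1 0, k 0 0]) := by
    rw [Units.val_mul, GL_inv_apply, Matrix.adjugate_fin_two]
  refine ⟨⟨?_, ?_⟩, ?_⟩ <;> rw [hmul] <;>
    simp only [Matrix.mul_apply, Fin.sum_univ_two, Matrix.smul_apply, Matrix.of_apply,
      Matrix.cons_val', Matrix.cons_val_zero, Matrix.cons_val_one, smul_eq_mul,
      Matrix.cons_val_fin_one, h00, h10, h11]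
  · rw [show z * k 1 0 * (D * k 1 1) + k 1 1 * (D * -k 1 0) =
      (z * D * k 1 1 - k 1 1 * D) * k 1 0 by ring]
    exact J.mul_mem_left _ hk'
  · rw [show k 0 0 * (D * k 1 1) + l 0 1 * (D * -k 1 0) - 1 =
      (D * k 0 1 - l 0 1 * D) * k 1 0 by linear_combination hdet]
    exact J.mul_mem_left _ hk'
  · rw [show z * k 1 0 * (D * -k 0 1) + k 1 1 * (D * k 0 0) - 1 =
      (D * k 0 1 - z * D * k 0 1) * k 1 0 by linear_combination hdet]
    exact J.mul_mem_left _ hk'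

lemma exists_ne_top_forall_mul_diag_mul_mem (k : Matrix (Fin 2) (Fin 2) R) {z : R}
    (hk : ¬ IsCoprime (k 0 0) z) : ∃ I : Ideal R, I ≠ ⊤ ∧
      ∀ (a : Matrix (Fin 2) (Fin 2) R) (i : Fin 2), (a * (!![1, 0; 0, z] * k)) i 0 ∈ I := by
  refine ⟨Ideal.span {k 0 0, z}, ?_, fun a i => ?_⟩
  · rwa [Ne, Ideal.eq_top_iff_one, Ideal.mem_span_pair]
  · have hcol : (a * (!![1, 0; 0, z] * k)) i 0 = a i 0 * k 0 0 + a i 1 * k 1 0 * z := by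
      rw [Matrix.eta_fin_two k, Matrix.mul_fin_two]
      simp only [Matrix.mul_apply, Fin.sum_univ_two, Matrix.of_apply, Matrix.cons_val',
        Matrix.cons_val_zero, Matrix.cons_val_one, Matrix.cons_val_fin_one]
      ring
    exact Ideal.mem_span_pair.2 ⟨_, _, hcol.symm⟩

end Matrices

section Components

variable {F : Type*} [Field F] [NumberField F] {p : ℕ}

lemma map_mem_localGamma {R R' : Type*} [CommRing R] [CommRing R'] (f : R →+* R') {I : Ideal R}
    {k : GL (Fin 2) R} (hk : k ∈ localGamma I) :
    Matrix.GeneralLinearGroup.map f k ∈ localGamma (I.map f) := by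
  obtain ⟨⟨h10, h00⟩, h11⟩ := hk
  exact ⟨⟨Ideal.mem_map_of_mem f h10, by simpa using Ideal.mem_map_of_mem f h00⟩,
    by simpa using Ideal.mem_map_of_mem f h11⟩

variable (p) in
/-- The component at `p` of an element of `GL₂(𝔯̂)`, as an element of `GL₂(𝔯_p)`. -/
noncomputable def pGL : U0 (⊤ : Ideal (𝓞 F)) →* GL (Fin 2) (Rp F p) :=
  MonoidHom.toHomUnits
    { toFun := fun u => pMat p u.1
      map_one' := pMat_one p
      map_mul' := fun u u' => pMat_mul p (U0_le_Delta0 _ _ u.2) (U0_le_Delta0 _ _ u'.2) }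

/-- The integral matrix over the finite adeles with given components. -/
noncomputable def adelicMatrix :
    (∀ w : HeightOneSpectrum (𝓞 F), Matrix (Fin 2) (Fin 2) (w.adicCompletionIntegers F)) →*
      Matrix (Fin 2) (Fin 2) (FiniteAdeleRing (𝓞 F) F) where
  toFun M := Matrix.of fun i j => ⟨fun w => M w i j, .of_forall fun w => (M w i j).2⟩
  map_one' := Matrix.ext fun i j => DFunLike.ext _ _ fun w => by
    fin_cases i <;> fin_cases j <;> rfl
  map_mul' M N := Matrix.ext fun i j => DFunLike.ext _ _ fun w => by
    change ((M w * N w) i j : w.adicCompletion F) = _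
    simp only [Matrix.mul_apply, Fin.sum_univ_two]
    rfl

/-- The element of `GL₂(𝔯̂)` with given components, as an element of `GL₂(F̂)`. -/
noncomputable def adelicGL :
    (∀ w : HeightOneSpectrum (𝓞 F), GL (Fin 2) (w.adicCompletionIntegers F)) →* GLf F :=
  (Units.map adelicMatrix).comp MulEquiv.piUnits.symm.toMonoidHom

lemma compAt_adelicGL (M : ∀ w : HeightOneSpectrum (𝓞 F), GL (Fin 2) (w.adicCompletionIntegers F))
    (w : HeightOneSpectrum (𝓞 F)) :
    compAt w (adelicGL M) = Matrix.GeneralLinearGroup.map (inclAt w) (M w) :=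
  Units.ext rfl

open Classical in
/-- The element of `GL₂(F̂)` with the components of `M` at the primes above `p` and the component
`1` at the other primes. -/
noncomputable def atP (M : GL (Fin 2) (Rp F p)) : GLf F :=
  adelicGL fun w => if h : (p : 𝓞 F) ∈ w.asIdeal then
    Matrix.GeneralLinearGroup.map (Pi.evalRingHom _ (⟨w, h⟩ : PlaceAbove F p)) M else 1

lemma compAt_atP_of_notMem (M : GL (Fin 2) (Rp F p)) {w : HeightOneSpectrum (𝓞 F)}
    (hw : (p : 𝓞 F) ∉ w.asIdeal) : compAt w (atP M) = 1 := by
  rw [atP, compAt_adelicGL, dif_neg hw, map_one]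

lemma compAt_atP (M : GL (Fin 2) (Rp F p)) (w : PlaceAbove F p) :
    compAt w.1 (atP M) = Matrix.GeneralLinearGroup.map (inclAt w.1)
      (Matrix.GeneralLinearGroup.map (Pi.evalRingHom _ w) M) := by
  rw [atP, compAt_adelicGL, dif_pos w.2]

lemma pMat_atP (M : GL (Fin 2) (Rp F p)) : pMat p (atP M) = M.1 :=
  Matrix.ext fun i j => funext fun w =>
    (congrArg (toInt w.1) congr($(compAt_atP M w) i j)).trans (toInt_coe _ _)

lemma compAt_eq_map_pGL (u : U0 (⊤ : Ideal (𝓞 F))) (w : PlaceAbove F p) :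
    compAt w.1 u.1 = Matrix.GeneralLinearGroup.map (inclAt w.1)
      (Matrix.GeneralLinearGroup.map (Pi.evalRingHom _ w) (pGL p u)) :=
  Units.ext <| Matrix.ext fun i j => (pMat_coe p (U0_le_Delta0 _ _ u.2) i j w).symm

lemma eq_of_pMat_eq {g h : GLf F} (hg : g ∈ Delta0 (⊤ : Ideal (𝓞 F)))
    (hh : h ∈ Delta0 (⊤ : Ideal (𝓞 F))) (hp : pMat p g = pMat p h)
    (haway : ∀ w : HeightOneSpectrum (𝓞 F), (p : 𝓞 F) ∉ w.asIdeal → compAt w g = compAt w h) :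
    g = h := by
  refine Units.ext <| Matrix.ext fun i j => DFunLike.ext _ _ fun w => ?_
  by_cases hw : (p : 𝓞 F) ∈ w.asIdeal
  · rw [← pMat_coe p hg i j ⟨w, hw⟩, hp, pMat_coe p hh]
  · exact congr($(haway w hw) i j)

lemma atP_mem_U1 {𝔪 : Ideal (𝓞 F)} (h𝔪 : IsCoprime (Ideal.span {(p : 𝓞 F)}) 𝔪)
    (M : GL (Fin 2) (Rp F p)) : atP M ∈ U1 𝔪 := by
  simp only [U1, globalize, Subgroup.mem_iInf, Subgroup.mem_comap, Subgroup.mem_map]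
  intro w
  by_cases hw : (p : 𝓞 F) ∈ w.asIdeal
  · have htop : idealAt 𝔪 w = ⊤ := idealAt_eq_top fun hle => w.isPrime.ne_top <| top_unique <|
      (Ideal.isCoprime_iff_sup_eq.1 h𝔪).ge.trans <|
        sup_le ((Ideal.span_singleton_le_iff_mem _).2 hw) hle
    exact ⟨_, htop ▸ ⟨trivial, trivial⟩, (compAt_atP M ⟨w, hw⟩).symm⟩
  · exact ⟨1, one_mem _, by rw [compAt_atP_of_notMem M hw, map_one]⟩

lemma mem_Ufull_of_pGL_mem (u : U0 (⊤ : Ideal (𝓞 F))) {α : ℕ}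
    (hu : pGL p u ∈ localGamma (Ideal.span {(p : Rp F p) ^ α})) :
    u.1 ∈ Ufull (Ideal.span {(p : 𝓞 F) ^ α}) := by
  simp only [Ufull, globalize, Subgroup.mem_iInf, Subgroup.mem_comap, Subgroup.mem_map]
  intro w
  by_cases hw : (p : 𝓞 F) ∈ w.asIdeal
  · refine ⟨_, ?_, (compAt_eq_map_pGL u ⟨w, hw⟩).symm⟩
    have h := map_mem_localGamma (Pi.evalRingHom _ ⟨w, hw⟩) hu
    simpa only [idealAt, Ideal.map_span, Set.image_singleton, map_pow, map_natCast] using h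
  · have htop : idealAt (Ideal.span {(p : 𝓞 F) ^ α}) w = ⊤ := idealAt_eq_top fun hle =>
      hw (w.isPrime.mem_of_pow_mem α ((Ideal.span_singleton_le_iff_mem _).1 hle))
    have hu0 := u.2
    simp only [U0, globalize, Subgroup.mem_iInf, Subgroup.mem_comap, Subgroup.mem_map] at hu0
    obtain ⟨l, -, hl⟩ := hu0 w
    exact ⟨l, htop ▸ ⟨⟨trivial, trivial⟩, trivial⟩, hl⟩

lemma TameLevel.atP_mem (S : TameLevel F p) (M : GL (Fin 2) (Rp F p)) : atP M ∈ S.S :=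
  S.U1_le (atP_mem_U1 S.cond_coprime M)

end Components

section DiagonalMatrices

variable {F : Type*} [Field F] [NumberField F] {p : ℕ}

lemma evalAt_det_diagOne (q : (FiniteAdeleRing (𝓞 F) F)ˣ) (w : HeightOneSpectrum (𝓞 F)) :
    evalAt w ((diagOne q).det : (FiniteAdeleRing (𝓞 F) F)ˣ) = (q : FiniteAdeleRing (𝓞 F) F) w := by
  rw [Matrix.GeneralLinearGroup.val_det_apply]
  exact congrArg (evalAt w) (by simp [diagOne])

lemma pMat_diagOne {q : (FiniteAdeleRing (𝓞 F) F)ˣ} {z : Rp F p}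
    (hq : ∀ w : PlaceAbove F p, (q : FiniteAdeleRing (𝓞 F) F) w.1 = z w) :
    pMat p (diagOne q) = !![1, 0; 0, z] := by
  refine Matrix.ext fun i j => funext fun w => ?_
  change toInt w.1 _ = _
  fin_cases i <;> fin_cases j
  · exact toInt_coe w.1 1
  · exact toInt_coe w.1 0
  · exact toInt_coe w.1 0
  · exact (congrArg (toInt w.1) (hq w)).trans (toInt_coe _ _)

lemma unitPart_diagOne_of_eq_one {q : (FiniteAdeleRing (𝓞 F) F)ˣ}
    (hq : ∀ w : PlaceAbove F p, (q : FiniteAdeleRing (𝓞 F) F) w.1 = 1) :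
    unitPart p (diagOne q) = 1 := by
  funext w
  rw [unitPart, evalAt_det_diagOne, hq, map_one, WithZero.log_one, zpow_zero, mul_one]
  exact toInt_coe w.1 1

lemma natCast_mem_nonZeroDivisors (hp : p ≠ 0) : (p : Rp F p) ∈ nonZeroDivisors (Rp F p) := by
  rw [mem_nonZeroDivisors_iff_left]
  refine fun y hy => funext fun w => (mul_eq_zero.1 (congrFun hy w)).resolve_left fun h => ?_
  have h' : algebraMap F (w.1.adicCompletion F) p = 0 := by
    simpa using congrArg Subtype.val h
  exact hp (Nat.cast_eq_zero.1 ((map_eq_zero _).1 h'))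

lemma valued_natCast_of_squarefree (hunr : Squarefree (Ideal.span {(p : 𝓞 F)}))
    (w : PlaceAbove F p) : Valued.v (p : w.1.adicCompletion F) = WithZero.exp (-1 : ℤ) := by
  have hval : Valued.v (p : w.1.adicCompletion F) = w.1.intValuation (p : 𝓞 F) := by
    rw [← map_natCast (algebraMap F (w.1.adicCompletion F)) p, ← map_natCast (algebraMap (𝓞 F) F) p,
      ← valuation_of_algebraMap (K := F)]
    exact valuedAdicCompletion_eq_valuation' w.1 _
  rw [hval]
  refine le_antisymm ((intValuation_le_pow_iff_mem _ _ 1).2 ?_)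
    (exp_le_intValuation_iff_emultiplicity_le (n := 1) _ |>.2 ?_)
  · rw [pow_one]
    exact w.2
  · exact ((squarefree_iff_emultiplicity_le_one _).1 hunr _).resolve_right w.1.prime.not_isUnit

lemma unitPart_diagOne_of_isPIdele (hunr : Squarefree (Ideal.span {(p : 𝓞 F)}))
    {ϖ : (FiniteAdeleRing (𝓞 F) F)ˣ} (hϖ : IsPIdele p ϖ) : unitPart p (diagOne ϖ) = 1 := by
  funext w
  have hp : (p : w.1.adicCompletion F) ≠ 0 := (Valuation.ne_zero_iff Valued.v).1 <| by
    rw [valued_natCast_of_squarefree hunr w]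
    exact WithZero.exp_ne_zero
  rw [unitPart, evalAt_det_diagOne, hϖ.1 w.1 w.2, valued_natCast_of_squarefree hunr,
    WithZero.log_exp, zpow_neg_one, mul_inv_cancel₀ hp]
  exact toInt_coe w.1 1

end DiagonalMatrices

section Symbols

variable {F : Type*} [Field F] [NumberField F] {p : ℕ} [Fact p.Prime] {S : TameLevel F p}
  {K : Type*} [NormedField K] [IsUltrametricDist K] [CharZero K] [NormedAlgebra ℚ_[p] K]
  [FiniteDimensional ℚ_[p] K]

namespace ArithWeight

variable (κ : ArithWeight S K)

lemma powV_one : κ.powV 1 = 1 := by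
  simp [powV]

lemma powV_natCast_prime :
    κ.powV (p : Rp F p) = ∏ σ : F →+* K, (p : K) ^ κ.v σ := by
  simp [powV]

lemma rho_measAct_eq_zero_of_not_isCoprime {q : (FiniteAdeleRing (𝓞 F) F)ˣ}
    (hq : IsIntegralIdele q) {z : Rp F p}
    (hqz : ∀ w : PlaceAbove F p, (q : FiniteAdeleRing (𝓞 F) F) w.1 = z w)
    (hunit : IsUnit (unitPart p (diagOne q))) {a k : GLf F} (ha : a ∈ S.S) (hk : k ∈ S.S)
    (hcop : ¬ IsCoprime (pMat p k 0 0) z) (μ : Meas S K) :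
    κ.rho (measAct S (a * diagOne q * k) μ) = 0 := by
  have ha' := S.le_U0_top ha
  have hk' := S.le_U0_top hk
  have hx := diagOne_mem hq ⊤
  obtain ⟨I, hI, hcol⟩ := exists_ne_top_forall_mul_diag_mul_mem (pMat p k) hcop
  refine κ.rho_measAct_eq_zero ?_ hI (fun i => ?_) μ
  · rw [unitPart_mul_unit _ hk', unitPart_unit_mul _ ha']
    exact ((isUnit_det_pMat p ha').mul hunit).mul (isUnit_det_pMat p hk')
  · rw [mul_assoc, pMat_mul p (U0_le_Delta0 _ _ ha') (mul_mem hx (U0_le_Delta0 _ _ hk')),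
      pMat_mul p hx (U0_le_Delta0 _ _ hk'), pMat_diagOne hqz]
    exact hcol _ i

lemma rho_measAct_mul_mul {x : GLf F} (hx : x ∈ Delta0 (Ideal.span {(p : 𝓞 F) ^ κ.α}))
    (hunit : IsUnit (unitPart p x)) {t : K}
    (ht : κ.powV (unitPart p x) = t * κ.powV (pMat p x).det) {a b : GLf F}
    (ha : a ∈ U0 (Ideal.span {(p : 𝓞 F) ^ κ.α})) (hb : b ∈ U0 (Ideal.span {(p : 𝓞 F) ^ κ.α}))
    (μ : Meas S K) : κ.rho (measAct S (a * x * b) μ) = κ.slash t (a * x * b) (κ.rho μ) := by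
  have ha' := U0_mono le_top ha
  have hb' := U0_mono le_top hb
  have hx' := Delta0_mono le_top hx
  have hu : unitPart p (a * x * b) = (pMat p a).det * unitPart p x * (pMat p b).det := by
    rw [unitPart_mul_unit _ hb', unitPart_unit_mul _ ha']
  have hdet : (pMat p (a * x * b)).det = (pMat p a).det * (pMat p x).det * (pMat p b).det := by
    rw [pMat_mul p (mul_mem (U0_le_Delta0 _ _ ha') hx') (U0_le_Delta0 _ _ hb'),
      pMat_mul p (U0_le_Delta0 _ _ ha') hx', Matrix.det_mul, Matrix.det_mul]
  refine κ.rho_measAct (mul_mem (mul_mem (U0_le_Delta0 _ _ ha) hx) (U0_le_Delta0 _ _ hb)) ?_ ?_ μ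
  · rw [hu]
    exact ((isUnit_det_pMat p ha').mul hunit).mul (isUnit_det_pMat p hb')
  · rw [hu, hdet]
    simp only [powV_mul, ht]
    ring

namespace Level

variable {κ} (V : κ.Level)

lemma mem_of_pGL_mul_inv_mem {u : GLf F} (hu : u ∈ V.U) {y : U0 (⊤ : Ideal (𝓞 F))}
    (hy : y.1 ∈ S.S)
    (h : pGL p (y * ⟨u, S.le_U0_top (V.le_S hu)⟩⁻¹) ∈
      localGamma (Ideal.span {(p : Rp F p) ^ κ.α})) :
    y.1 ∈ V.U := by
  have hyu : y.1 * u⁻¹ ∈ V.U :=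
    V.ge ⟨S.S.mul_mem hy (S.S.inv_mem (V.le_S hu)), mem_Ufull_of_pGL_mem _ h⟩
  simpa using V.U.mul_mem hyu hu

lemma conj_diagOne_mem {q : (FiniteAdeleRing (𝓞 F) F)ˣ} (hq : IsIntegralIdele q) {z : Rp F p}
    (hqz : ∀ w : PlaceAbove F p, (q : FiniteAdeleRing (𝓞 F) F) w.1 = z w)
    (hz : z ∈ nonZeroDivisors (Rp F p)) {u : GLf F} (hu : u ∈ V.U)
    (hS : diagOne q * u * (diagOne q)⁻¹ ∈ S.S) : diagOne q * u * (diagOne q)⁻¹ ∈ V.U := by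
  have hu' := S.le_U0_top (V.le_S hu)
  have hy := S.le_U0_top hS
  refine V.mem_of_pGL_mul_inv_mem hu (y := ⟨_, hy⟩) hS ?_
  rw [map_mul, map_inv]
  refine mul_inv_mem_localGamma_of_mul_diag_eq hz (pMat_mem_span (U0_le_Delta0 _ _ (V.le_U0 hu))) ?_
  have hx := diagOne_mem hq ⊤
  have h := congrArg (pMat p) (inv_mul_cancel_right (diagOne q * u) (diagOne q))
  rwa [pMat_mul p (U0_le_Delta0 _ _ hy) hx, pMat_mul p hx (U0_le_Delta0 _ _ hu'),
    pMat_diagOne hqz] at h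

lemma exists_mem_mul_mul_inv_mem {x k : GLf F} (hx : x ∈ Delta0 (⊤ : Ideal (𝓞 F))) (hk : k ∈ S.S)
    {M L : GL (Fin 2) (Rp F p)} (hM : M ∈ localGamma (Ideal.span {(p : Rp F p) ^ κ.α}))
    (hL : L.1 * (pMat p x * M.1) = pMat p x * pMat p k) :
    ∃ u ∈ V.U, x * k * (x * u)⁻¹ ∈ S.S := by
  have hk' := S.le_U0_top hk
  -- The element `u` has the component `M` at `p` and agrees with `k` away from `p`.
  let N := M * (pGL p ⟨k, hk'⟩)⁻¹
  have hN := S.atP_mem N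
  have hL' := S.atP_mem L
  let u := atP N * k
  have hu : u ∈ S.S := S.S.mul_mem hN hk
  have hu' := S.le_U0_top hu
  have hΔ : ∀ {y}, y ∈ S.S → y ∈ Delta0 (⊤ : Ideal (𝓞 F)) := fun hy =>
    U0_le_Delta0 _ _ (S.le_U0_top hy)
  have hpu : pGL p ⟨u, hu'⟩ = M := Units.ext <| by
    change pMat p (atP N * k) = _
    rw [pMat_mul p (hΔ hN) (hΔ hk), pMat_atP]
    exact congrArg Units.val (inv_mul_cancel_right M (pGL p ⟨k, hk'⟩))
  have hxk : x * k = atP L * (x * u) := by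
    refine eq_of_pMat_eq (p := p) (mul_mem hx (hΔ hk)) (mul_mem (hΔ hL') (mul_mem hx (hΔ hu))) ?_
      fun w hw => ?_
    · rw [pMat_mul p hx (hΔ hk), pMat_mul p (hΔ hL') (mul_mem hx (hΔ hu)), pMat_mul p hx (hΔ hu),
        pMat_atP, ← hL, ← hpu]
      rfl
    · simp only [u, map_mul, compAt_atP_of_notMem _ hw, one_mul]
  refine ⟨u, V.ge ⟨hu, mem_Ufull_of_pGL_mem ⟨u, hu'⟩ (hpu ▸ hM)⟩, ?_⟩
  rwa [hxk, mul_inv_cancel_right]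

lemma mk_mem_image_cosetMap_of_isCoprime {q : (FiniteAdeleRing (𝓞 F) F)ˣ} (hq : IsIntegralIdele q)
    {z : Rp F p} (hqz : ∀ w : PlaceAbove F p, (q : FiniteAdeleRing (𝓞 F) F) w.1 = z w)
    {a k : GLf F} (ha : a ∈ S.S) (hk : k ∈ S.S) (hcop : IsCoprime (pMat p k 0 0) z) :
    Quotient.mk _ (a * diagOne q * k) ∈ cosetMap V.le_S '' doubleCosets V.U (diagOne q) := by
  obtain ⟨L, b, hL⟩ := exists_mul_diag_upperRightHom (pGL p ⟨k, S.le_U0_top hk⟩) hcop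
  rw [← pMat_diagOne hqz] at hL
  obtain ⟨u, hu, hS⟩ :=
    V.exists_mem_mul_mul_inv_mem (diagOne_mem hq ⊤) hk (upperRightHom_mem_localGamma _ b) hL
  refine mk_mem_image_cosetMap V.le_S hu ?_
  simpa only [mul_assoc] using S.S.mul_mem ha hS

lemma rho_T_diagOne {q : (FiniteAdeleRing (𝓞 F) F)ˣ} (hq : IsIntegralIdele q) {z : Rp F p}
    (hqz : ∀ w : PlaceAbove F p, (q : FiniteAdeleRing (𝓞 F) F) w.1 = z w)
    (hz : z ∈ nonZeroDivisors (Rp F p)) (hunit : IsUnit (unitPart p (diagOne q))) {t : K}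
    (ht : κ.powV (unitPart p (diagOne q)) = t * κ.powV z) (Φ : LambdaSymbols S K) :
    V.rho (LambdaSymbols.T S K (diagOne q) (diagOne_mem hq _) Φ) =
      V.scaledT t (diagOne q) (diagOne_mem hq _) (V.rho Φ) := by
  have hdet : (pMat p (diagOne q)).det = z := by
    rw [pMat_diagOne hqz, Matrix.det_fin_two_of, one_mul, mul_zero, sub_zero]
  have hinj : Set.InjOn (cosetMap V.le_S) (doubleCosets V.U (diagOne q)) :=
    cosetMap_injOn_doubleCosets V.le_S fun u hu => V.conj_diagOne_mem hq hqz hz hu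
  have hcomm : ∀ a ∈ V.U, ∀ b ∈ V.U, ∀ μ : Meas S K, κ.rho (measAct S (a * diagOne q * b) μ) =
      κ.slash t (a * diagOne q * b) (κ.rho μ) := fun a ha b hb μ =>
    κ.rho_measAct_mul_mul (diagOne_mem hq _) hunit (hdet.symm ▸ ht) (V.le_U0 ha) (V.le_U0 hb) μ
  have hzero : ∀ a ∈ S.S, ∀ b ∈ S.S,
      Quotient.mk _ (a * diagOne q * b) ∉ cosetMap V.le_S '' doubleCosets V.U (diagOne q) →
        ∀ μ : Meas S K, κ.rho (measAct S (a * diagOne q * b) μ) = 0 := fun a ha b hb hab μ =>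
    κ.rho_measAct_eq_zero_of_not_isCoprime hq hqz hunit ha hb (fun hcop =>
      hab (V.mk_mem_image_cosetMap_of_isCoprime hq hqz ha hb hcop)) μ
  exact Hcpt.map_pushCochain_hecke (R := OK K) (E := Meas S K) (E' := κ.L) V.le_S S.isOpen
    S.isCompact V.isOpen V.isCompact (measAct_compat S (diagOne_mem hq _))
    (κ.slash_compat V.le_U0 t (diagOne_mem hq _)) κ.rho
    (fun u hu μ => κ.rho_equivariant (V.le_U0 hu) μ) hinj hcomm hzero (Module.finrank ℚ F) Φ

lemma rho_T_of_eq_one_above {q : (FiniteAdeleRing (𝓞 F) F)ˣ} (hq : IsIntegralIdele q)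
    (hq1 : ∀ w : PlaceAbove F p, (q : FiniteAdeleRing (𝓞 F) F) w.1 = 1) (Φ : LambdaSymbols S K) :
    V.rho (LambdaSymbols.T S K (diagOne q) (diagOne_mem hq _) Φ) =
      V.T (diagOne q) (diagOne_mem hq _) (V.rho Φ) := by
  have hunit := unitPart_diagOne_of_eq_one hq1
  exact V.rho_T_diagOne hq (z := 1) hq1 (one_mem _) (hunit ▸ isUnit_one)
    (by rw [hunit, one_mul]) Φ

lemma rho_T_of_isPIdele (hunr : Squarefree (Ideal.span {(p : 𝓞 F)}))
    {ϖ : (FiniteAdeleRing (𝓞 F) F)ˣ} (hϖ : IsPIdele p ϖ) (Φ : LambdaSymbols S K) :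
    V.rho (LambdaSymbols.T S K (diagOne ϖ) (diagOne_mem hϖ.isIntegral _) Φ) =
      V.T0 ϖ hϖ (V.rho Φ) := by
  have hunit := unitPart_diagOne_of_isPIdele hunr hϖ
  refine V.rho_T_diagOne hϖ.isIntegral (z := p) (fun w => hϖ.1 w.1 w.2) ?_ (hunit ▸ isUnit_one) ?_ Φ
  · exact natCast_mem_nonZeroDivisors (Fact.out : p.Prime).ne_zero
  · rw [hunit, κ.powV_one, κ.powV_natCast_prime]
    exact (inv_mul_cancel₀ (Finset.prod_ne_zero_iff.2 fun σ _ =>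
      zpow_ne_zero _ (natCast_prime_ne_zero p))).symm

end Level

end ArithWeight

end Symbols

end HilbertSymbols

theorem mainTheorem9_general {F : Type*} [Field F] [NumberField F] {p : ℕ} [Fact p.Prime]
    (S : TameLevel F p)
    {K : Type*} [NormedField K] [IsUltrametricDist K] [CharZero K] [NormedAlgebra ℚ_[p] K]
    [FiniteDimensional ℚ_[p] K] (κ : ArithWeight S K) (V : κ.Level) (Φ : LambdaSymbols S K) :
    (∀ 𝔮 : HeightOneSpectrum (𝓞 F), (p : 𝓞 F) ∉ 𝔮.asIdeal →
      ∀ (q : (FiniteAdeleRing (𝓞 F) F)ˣ) (hq : IsPrimeIdele 𝔮 q),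
        V.rho (LambdaSymbols.T S K (diagOne q) (diagOne_mem hq.isIntegral _) Φ) =
          V.T (diagOne q) (diagOne_mem hq.isIntegral _) (V.rho Φ)) ∧
    (Squarefree (Ideal.span {(p : 𝓞 F)}) →
      ∀ (ϖ : (FiniteAdeleRing (𝓞 F) F)ˣ) (hϖ : IsPIdele p ϖ),
        V.rho (LambdaSymbols.T S K (diagOne ϖ) (diagOne_mem hϖ.isIntegral _) Φ) =
          V.T0 ϖ hϖ (V.rho Φ)) := by
  refine ⟨fun 𝔮 h𝔮 q hq => ?_, fun hunr ϖ hϖ => V.rho_T_of_isPIdele hunr hϖ Φ⟩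
  have hq1 : ∀ w : PlaceAbove F p, (q : FiniteAdeleRing (𝓞 F) F) w.1 = 1 := fun w =>
    hq.2 w.1 fun h => h𝔮 (h ▸ w.2)
  exact V.rho_T_of_eq_one_above hq.isIntegral hq1 Φ

theorem mainTheorem9 {F : Type*} [Field F] [NumberField F] [NumberField.IsTotallyReal F]
    {p : ℕ} [Fact p.Prime] (hp : p ≠ 2) (hunr : Squarefree (Ideal.span {(p : 𝓞 F)}))
    (S : TameLevel F p)
    {K : Type*} [NormedField K] [IsUltrametricDist K] [CharZero K] [NormedAlgebra ℚ_[p] K]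
    [FiniteDimensional ℚ_[p] K] (hK : Nat.card (F →+* K) = Module.finrank ℚ F)
    (κ : ArithWeight S K) (V : κ.Level) (Φ : LambdaSymbols S K) :
    (∀ 𝔮 : HeightOneSpectrum (𝓞 F), (p : 𝓞 F) ∉ 𝔮.asIdeal →
      ∀ (q : (FiniteAdeleRing (𝓞 F) F)ˣ) (hq : IsPrimeIdele 𝔮 q),
        V.rho (LambdaSymbols.T S K (diagOne q) (diagOne_mem hq.isIntegral _) Φ) =
          V.T (diagOne q) (diagOne_mem hq.isIntegral _) (V.rho Φ)) ∧
    (∀ (ϖ : (FiniteAdeleRing (𝓞 F) F)ˣ) (hϖ : IsPIdele p ϖ),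
      V.rho (LambdaSymbols.T S K (diagOne ϖ) (diagOne_mem hϖ.isIntegral _) Φ) =
        V.T0 ϖ hϖ (V.rho Φ)) := by
  have hgeneral := mainTheorem9_general S κ V Φ
  exact ⟨hgeneral.1, hgeneral.2 hunr⟩
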